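/- Let $Q$ be a smooth (Hausdorff, second countable, finite-dimensional) manifold with a Riemannian metric $\langle\cdot,\cdot\rangle$, let $L(v)=\tfrac12\langle v,v\rangle-V(q)$ ($v\in T_qQ$) be a Lagrangian with smooth potential $V$, and let $\mathcal D=\bigcap_{j=1}^k\ker\phi^j\subseteq TQ$ be the constraint distribution defined by smooth, pointwise linearly independent $1$-forms $\phi^1,\dots,\phi^k$ on $Q$. Let $\mathbb FL:TQ\to T^*Q$, $v\mapsto\langle v,\cdot\rangle$, be the Legendre transformation, $M:=\mathbb FL(\mathcal D)\subseteq T^*Q$ the constraint submanifold, $\pi:T^*Q\to Q$ the projection, $\omega_M$ the pull back to $M$ of the canonical symplectic form of $T^*Q$, and $\mathcal H:=TM\cap(T\pi)^{-1}(\mathcal D)$. Let $D\subseteq TM\oplus T^*M$ be the Dirac structure $$D(m)=\{(v,\alpha)\in T_mM\oplus T_m^*M\mid v\in\mathcal H(m),\ \alpha-\mathbf i_v\omega_M\in\mathcal H^\circ(m)\}.$$ Let $G$ be a Lie group with Lie algebra $\mathfrak g$ acting smoothly, freely and properly on $Q$, leaving $\mathcal D$ and $L$ invariant; $G$ acts on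 $T^*Q$ by the cotangent lift, and this action restricts to $M$. For $\xi\in\mathfrak g$ let $\xi_Q$, $\xi_M$ be the infinitesimal generators on $Q$ and $M$, and let $\mathbf J^\xi(p)=\langle p,\xi_Q(\pi(p))\rangle$, $p\in M$, be the $\xi$-component of the momentum map. Put $\mathcal V(m)=\{\eta_M(m)\mid\eta\in\mathfrak g\}$, $\mathcal U=(\mathcal V\cap\mathcal H)^{\omega_M}\cap\mathcal H$, and let $\mathcal R\subseteq\mathcal H^\circ$ be the reaction codistribution $$\mathcal R(m)=\{\beta(m)\mid\beta\in\Gamma(\mathcal H^\circ)\text{ and there is }X\in\Gamma(\mathcal U)\text{ with }\beta+\mathbf i_X\omega_M\in\Gamma(\mathcal V^\circ)\},$$ where $\Gamma$ denotes smooth local sections near $m$. Let $\mathcal R^\circ\subseteq TM$ be its smooth annihilator, whose fibre at $m$ consists of the values at $m$ of the smooth local vector fields on $M$ that annihilate all local sections of $\mathcal R$ defined near $m$. **Theorem.** Let $\xi\in\mathfrak g$. The function $\mathbf J^\xi$ is a constant of motion for every $G$-invariant Hamiltonian $h\in C^\infty(M)^G$ (that is, for each such $h$, $\mathbf J^\xi$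 is constant along every smooth curve $c:(a,b)\to M$ with $(\dot c(t),\mathbf dh(c(t)))\in D(c(t))$ for all $t$) if and only if $\xi_M\in\Gamma(\mathcal V\cap\mathcal R^\circ)$. -/

import Mathlib

open Bundle Set
open scoped Manifold ContDiff

noncomputable section

namespace Nonholonomic

section Basic

variable (E : Type*) [NormedAddCommGroup E] [NormedSpace ℝ E]
variable (Q : Type*) [TopologicalSpace Q] [ChartedSpace E Q] [IsManifold 𝓘(ℝ, E) ∞ Q]

/-- The cotangent bundle `T*Q`, with Mathlib's manifold structure as a vector bundle over `Q`. -/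
abbrev Cot : Type _ :=
  TotalSpace (E →L[ℝ] ℝ) (fun q : Q => TangentSpace 𝓘(ℝ, E) q →L[ℝ] ℝ)

/-- The model with corners of `T*Q` (a manifold modelled on `E × E*`). -/
abbrev cotModel : ModelWithCorners ℝ (E × (E →L[ℝ] ℝ)) (ModelProd E (E →L[ℝ] ℝ)) :=
  𝓘(ℝ, E).prod 𝓘(ℝ, E →L[ℝ] ℝ)

variable {E Q}

/-- The tangent space of `T*Q` at `p`. -/
abbrev TCot (p : Cot E Q) : Type _ := TangentSpace (cotModel E) p

/-- The canonical symplectic form `ω_can = ∑ dqⁱ ∧ dpᵢ` of `T*Q`.  Mathlib identifies `T_p(T*Q)`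
with `E × E*` by the preferred chart of `T*Q` at `p`, which is the canonical cotangent chart
`(q, p)` induced by the preferred chart of `Q` at the base point of `p`; in a canonical
cotangent chart `ω_can ((δq, δp), (δq', δp')) = δp' (δq) - δp (δq')`. -/
def omegaCan (p : Cot E Q) : TCot p →L[ℝ] TCot p →L[ℝ] ℝ :=
  let B : (E × (E →L[ℝ] ℝ)) →L[ℝ] (E × (E →L[ℝ] ℝ)) →L[ℝ] ℝ :=
    (ContinuousLinearMap.id ℝ (E →L[ℝ] ℝ)).bilinearComp
      (ContinuousLinearMap.snd ℝ E (E →L[ℝ] ℝ)) (ContinuousLinearMap.fst ℝ E (E →L[ℝ] ℝ))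
  B.flip - B

/-- The differential of the cotangent bundle projection `π : T*Q → Q`. -/
def tangentProj (p : Cot E Q) : TCot p →L[ℝ] TangentSpace 𝓘(ℝ, E) p.proj :=
  mfderiv (cotModel E) 𝓘(ℝ, E) (fun x : Cot E Q => x.proj) p

/-- The differential of a real function on `T*Q`. -/
def diff (f : Cot E Q → ℝ) (p : Cot E Q) : TCot p →L[ℝ] ℝ :=
  mfderiv (cotModel E) 𝓘(ℝ, ℝ) f p

end Basic

/-- A nonholonomic system on the configuration manifold `Q`: a Riemannian metric and a potential
(so that the Lagrangian is kinetic minus potential energy) and `k` pointwise linearly independent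
smooth constraint `1`-forms. -/
structure System (E : Type*) [NormedAddCommGroup E] [NormedSpace ℝ E]
    (Q : Type*) [TopologicalSpace Q] [ChartedSpace E Q] [IsManifold 𝓘(ℝ, E) ∞ Q] where
  metric : ContMDiffRiemannianMetric 𝓘(ℝ, E) ∞ E (fun q : Q => TangentSpace 𝓘(ℝ, E) q)
  potential : Q → ℝ
  smooth_potential : ContMDiff 𝓘(ℝ, E) 𝓘(ℝ, ℝ) ∞ potential
  /-- number of constraints -/
  k : ℕ
  /-- constraint forms -/
  φ : Fin k → (q : Q) → TangentSpace 𝓘(ℝ, E) q →L[ℝ] ℝ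
  smooth_φ : ∀ j, ContMDiff 𝓘(ℝ, E) (cotModel E) ∞
    (fun q : Q => (⟨q, φ j q⟩ : Cot E Q))
  linearIndependent_φ : ∀ q, LinearIndependent ℝ (fun j => φ j q)

namespace System

variable {E : Type*} [NormedAddCommGroup E] [NormedSpace ℝ E]
variable {Q : Type*} [TopologicalSpace Q] [ChartedSpace E Q] [IsManifold 𝓘(ℝ, E) ∞ Q]
variable (S : System E Q)

/-- The constraint distribution `𝒟 ⊆ TQ`. -/
def constraint (q : Q) : Submodule ℝ (TangentSpace 𝓘(ℝ, E) q) :=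
  ⨅ j, LinearMap.ker (S.φ j q : TangentSpace 𝓘(ℝ, E) q →ₗ[ℝ] ℝ)

/-- The Lagrangian `L(v) = ½⟨v, v⟩ - V(q)`, `v ∈ T_qQ`. -/
def lagrangian (q : Q) (v : TangentSpace 𝓘(ℝ, E) q) : ℝ :=
  1 / 2 * S.metric.inner q v v - S.potential q

/-- The Legendre transformation `𝔽L : T_qQ → T*_qQ`, which for a Lagrangian of the form kinetic
minus potential energy is `v ↦ ⟨v, ·⟩`, see `hasDerivAt_lagrangian`. -/
def legendre (q : Q) : TangentSpace 𝓘(ℝ, E) q →L[ℝ] (TangentSpace 𝓘(ℝ, E) q →L[ℝ] ℝ) :=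
  S.metric.inner q

/-- `⟨𝔽L(v), w⟩ = d/dt|_{t=0} L(v + t w)`. -/
theorem hasDerivAt_lagrangian (q : Q) (v w : TangentSpace 𝓘(ℝ, E) q) :
    HasDerivAt (fun t : ℝ => S.lagrangian q (v + t • w)) (S.legendre q v w) 0 := by
  have h : (fun t : ℝ => S.lagrangian q (v + t • w)) = fun t : ℝ =>
      S.lagrangian q v + t * S.legendre q v w + 1 / 2 * S.legendre q w w * t ^ 2 := by
    funext t
    simp only [lagrangian, legendre, map_add, map_smul, add_apply,
      smul_apply, smul_eq_mul, S.metric.symm q w v]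
    ring
  rw [h]
  have h1 := ((hasDerivAt_id (0 : ℝ)).mul_const (S.legendre q v w)).const_add (S.lagrangian q v)
  have h2 := ((hasDerivAt_id (0 : ℝ)).pow 2).const_mul (1 / 2 * S.legendre q w w)
  simpa using HasDerivAt.fun_add h1 h2

/-- The constraints in phase space, `ψʲ(p) = φʲ(𝔽L⁻¹(p))`. -/
def phaseConstraint (j : Fin S.k) (p : Cot E Q) : ℝ :=
  S.φ j p.proj ((S.legendre p.proj).inverse p.2)

/-- The constraint manifold `M = 𝔽L(𝒟) = {p | φʲ(𝔽L⁻¹(p)) = 0, j = 1, …, k} ⊆ T*Q`. It is the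
common zero set of the independent smooth functions `ψʲ`, hence a closed embedded submanifold of
`T*Q`. -/
def M : Set (Cot E Q) := {p | ∀ j, S.phaseConstraint j p = 0}

/-- The tangent space `T_pM`, `p ∈ M`, as the subspace `⋂ⱼ ker dψʲ(p)` of `T_p(T*Q)`. -/
def TM (p : Cot E Q) : Submodule ℝ (TCot p) :=
  ⨅ j, LinearMap.ker (diff (S.phaseConstraint j) p : TCot p →ₗ[ℝ] ℝ)

/-- The nonholonomic horizontal distribution `ℋ = TM ∩ (Tπ)⁻¹(𝒟)`. -/
def Hor (p : Cot E Q) : Submodule ℝ (TCot p) :=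
  S.TM p ⊓ (S.constraint p.proj).comap (tangentProj p : TCot p →ₗ[ℝ] _)

/-- A generalized distribution on `M` is a family of sets `Δ p ⊆ T_pM ⊆ T_p(T*Q)`, `p ∈ M`.
A local section of `Δ` over `M ∩ O`, `O` open in `T*Q`, is represented by a smooth vector field
`X` on `O` with `X p ∈ Δ p` for `p ∈ M ∩ O`: as `M` is an embedded submanifold, smooth vector
fields on `M` are locally restrictions of smooth vector fields on `T*Q` that are tangent
to `M`. -/
def IsSectionOn (O : Set (Cot E Q)) (Δ : ∀ p : Cot E Q, Set (TCot p))
    (X : ∀ p : Cot E Q, TCot p) : Prop :=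
  IsOpen O ∧
  ContMDiffOn (cotModel E) (cotModel E).tangent ∞
    (fun p => (⟨p, X p⟩ : TangentBundle (cotModel E) (Cot E Q))) O ∧
  ∀ p ∈ O ∩ S.M, X p ∈ S.TM p ∧ X p ∈ Δ p

/-- The restriction of a covector of `T*Q` at `p` to `T_pM`, an element of `T_p*M`. -/
def restrict (p : Cot E Q) (β : TCot p →L[ℝ] ℝ) : Module.Dual ℝ (S.TM p) :=
  (β : TCot p →ₗ[ℝ] ℝ).domRestrict (S.TM p)

/-- A generalized codistribution on `M` is a family of sets `Ξ p ⊆ T_p*M`, `p ∈ M`. A local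
section of `Ξ` over `M ∩ O` is represented by a smooth `1`-form `β` on `O` with
`β(p)|_{T_pM} ∈ Ξ p` for `p ∈ M ∩ O`. -/
def IsCosectionOn (O : Set (Cot E Q)) (Ξ : ∀ p : Cot E Q, Set (Module.Dual ℝ (S.TM p)))
    (β : ∀ p : Cot E Q, TCot p →L[ℝ] ℝ) : Prop :=
  IsOpen O ∧
  ContMDiffOn (cotModel E) ((cotModel E).prod 𝓘(ℝ, (E × (E →L[ℝ] ℝ)) →L[ℝ] ℝ)) ∞
    (fun p => TotalSpace.mk' (E := fun p : Cot E Q => TCot p →L[ℝ] ℝ)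
      ((E × (E →L[ℝ] ℝ)) →L[ℝ] ℝ) p (β p)) O ∧
  ∀ p ∈ O ∩ S.M, S.restrict p (β p) ∈ Ξ p

/-- The fibrewise annihilator in `T*M`, used for the vector subbundles `ℋ` and `𝒱` of `TM`. -/
def annihilator (Δ : ∀ p : Cot E Q, Submodule ℝ (TCot p)) (p : Cot E Q) :
    Set (Module.Dual ℝ (S.TM p)) :=
  {β | ∀ v : S.TM p, (v : TCot p) ∈ Δ p → β v = 0}

/-- The smooth annihilator `Ξ° ⊆ TM` of a codistribution `Ξ` on `M`: the values at `p` of local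
vector fields on `M` that annihilate all local sections of `Ξ` defined near `p`. -/
def smoothCoannihilator (Ξ : ∀ p : Cot E Q, Set (Module.Dual ℝ (S.TM p))) (p : Cot E Q) :
    Set (TCot p) :=
  {v | ∃ (O : Set (Cot E Q)) (X : ∀ q : Cot E Q, TCot q), p ∈ O ∧
    S.IsSectionOn O (fun q => S.TM q) X ∧ X p = v ∧
    ∀ (O' : Set (Cot E Q)) (β : ∀ q : Cot E Q, TCot q →L[ℝ] ℝ), p ∈ O' →
      S.IsCosectionOn O' Ξ β → ∀ q ∈ O ∩ O' ∩ S.M, β q (X q) = 0}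

/-- The Dirac structure of the nonholonomic system, `D(p) ⊆ T_pM ⊕ T_p*M`:
`(v, α) ∈ D(p)` iff `v ∈ ℋ(p)` and `α - i_v ω_M ∈ ℋ°(p)`. -/
def dirac (p : Cot E Q) : Set (TCot p × Module.Dual ℝ (S.TM p)) :=
  {x | x.1 ∈ S.Hor p ∧ x.2 - S.restrict p (omegaCan p x.1) ∈ S.annihilator S.Hor p}

/-- `c`, on the time interval `(a, b)`, is a solution curve of the implicit Hamiltonian system
`(ċ, dh(c)) ∈ D(c)` on `M` with Hamiltonian `h|_M`. -/
def IsSolution (h : Cot E Q → ℝ) (a b : ℝ) (c : ℝ → Cot E Q) : Prop :=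
  ContMDiffOn 𝓘(ℝ, ℝ) (cotModel E) ∞ c (Ioo a b) ∧
  ∀ t ∈ Ioo a b, c t ∈ S.M ∧
    (mfderiv 𝓘(ℝ, ℝ) (cotModel E) c t (1 : ℝ), S.restrict (c t) (diff h (c t))) ∈ S.dirac (c t)

/-- For functions `h`, `f` on `T*Q`: `f|_M` is a constant of motion for the Hamiltonian `h|_M`: it is constant along every solution
curve. -/
def IsConstantOfMotion (h f : Cot E Q → ℝ) : Prop :=
  ∀ (a b : ℝ) (c : ℝ → Cot E Q), S.IsSolution h a b c →
    ∀ s ∈ Ioo a b, ∀ t ∈ Ioo a b, f (c s) = f (c t)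

end System

section Action

variable {E : Type*} [NormedAddCommGroup E] [NormedSpace ℝ E]
variable {Q : Type*} [TopologicalSpace Q] [ChartedSpace E Q] [IsManifold 𝓘(ℝ, E) ∞ Q]
variable {F : Type*} [NormedAddCommGroup F] [NormedSpace ℝ F]
variable {G : Type*} [TopologicalSpace G] [ChartedSpace F G] [Group G] [MulAction G Q]

/-- The tangent map `T_qφ_g : T_qQ → T_{g q}Q` of the action. -/
def tangentAct (g : G) (q : Q) : TangentSpace 𝓘(ℝ, E) q →L[ℝ] TangentSpace 𝓘(ℝ, E) (g • q) :=
  mfderiv 𝓘(ℝ, E) 𝓘(ℝ, E) (fun x : Q => g • x) q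

/-- The cotangent lift `Φ_g = (Tφ_{g⁻¹})*` of the action to `T*Q`: `Φ_g` maps `p ∈ T_q*Q` to
`p ∘ T_{g q}φ_{g⁻¹} ∈ T_{g q}*Q`. (The codomain of `T_{g q}φ_{g⁻¹}` is the tangent space at
`g⁻¹ • g • q = q`.) -/
def lift (g : G) (p : Cot E Q) : Cot E Q :=
  ⟨g • p.proj, ContinuousLinearMap.comp
    (show TangentSpace 𝓘(ℝ, E) (g⁻¹ • g • p.proj) →L[ℝ] ℝ from p.2)
    (tangentAct g⁻¹ (g • p.proj))⟩

/-- The infinitesimal generator `ξ_Q(q) = d/dt|_{t=0} exp(tξ) q`, i.e. the derivative at `1` of the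
orbit map `g ↦ g • q` in the direction `ξ`. (Its values lie in the tangent space at
`1 • q = q`.) -/
def generatorQ (ξ : GroupLieAlgebra 𝓘(ℝ, F) G) (q : Q) : TangentSpace 𝓘(ℝ, E) q :=
  mfderiv 𝓘(ℝ, F) 𝓘(ℝ, E) (fun g : G => g • q) 1 ξ

/-- `ξ ↦ ξ_{T*Q}(p)`: the derivative at `1` of the orbit map `g ↦ Φ_g(p)` of the lifted action.
For `p ∈ M` this is also `ξ_M(p)`. -/
def generatorMap (p : Cot E Q) : GroupLieAlgebra 𝓘(ℝ, F) G →L[ℝ] TCot p :=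
  mfderiv 𝓘(ℝ, F) (cotModel E) (fun g : G => lift g p) 1

/-- The infinitesimal generator `ξ_{T*Q}`, restricting to `ξ_M` on `M`. -/
def generator (ξ : GroupLieAlgebra 𝓘(ℝ, F) G) (p : Cot E Q) : TCot p :=
  generatorMap p ξ

/-- The component `𝐉^ξ(p) = ⟨p, ξ_Q(π(p))⟩` of the canonical momentum map. -/
def momentum (ξ : GroupLieAlgebra 𝓘(ℝ, F) G) (p : Cot E Q) : ℝ :=
  p.2 (generatorQ ξ p.proj)

variable (F G) in
/-- The vertical distribution `𝒱(p) = {ξ_M(p) | ξ ∈ 𝔤}`, `p ∈ M`. -/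
def Ver (p : Cot E Q) : Submodule ℝ (TCot p) :=
  LinearMap.range (generatorMap (F := F) (G := G) p : GroupLieAlgebra 𝓘(ℝ, F) G →ₗ[ℝ] TCot p)

namespace System

variable (S : System E Q)

variable (F G) in
/-- `𝒰 = (𝒱 ∩ ℋ)^{ω_M} ∩ ℋ`. -/
def horAnn (p : Cot E Q) : Set (TCot p) :=
  {v | v ∈ S.Hor p ∧ ∀ w ∈ Ver F G p ⊓ S.Hor p, omegaCan p v w = 0}

variable (F G) in
/-- The reaction codistribution `ℛ`: `ℛ(p)` is the set of all `β(p)`, where `β` is a local section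
of `ℋ°` near `p` such that `β + i_X ω_M` is a section of `𝒱°` for some local section `X` of `𝒰`. -/
def reaction (p : Cot E Q) : Set (Module.Dual ℝ (S.TM p)) :=
  {l | ∃ (O : Set (Cot E Q)) (β : ∀ q : Cot E Q, TCot q →L[ℝ] ℝ) (X : ∀ q : Cot E Q, TCot q),
    p ∈ O ∧ S.IsCosectionOn O (S.annihilator S.Hor) β ∧
    S.IsSectionOn O (S.horAnn F G) X ∧
    S.IsCosectionOn O (S.annihilator (Ver F G)) (fun q => β q + omegaCan q (X q)) ∧
    l = S.restrict p (β p)}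

end System

end Action

end Nonholonomic

end

/-!
The theorem is true because of two facts. First, `d𝐉^ξ = i_{ξ_{T*Q}} ω` (`diff_momentum`), so that
the derivative of `𝐉^ξ` along a solution with velocity `X` is `ω(ξ_M, X)`. Secondly, the equations of
motion with Hamiltonian `h` say that `X ∈ ℋ` and that the reaction force `β = dh - i_X ω` annihilates
`ℋ`. If `h` is invariant then `dh(ξ_M) = 0`, and hence `d𝐉^ξ(X) = -ω(X, ξ_M) = β(ξ_M)`.

*Sufficiency.* As `ω` is nondegenerate on `ℋ`, the equations of motion determine `X`, and
`hamiltonianField` extends it to a smooth vector field on `T*Q`, the image of the unconstrained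
Hamiltonian vector field under the `ω`-orthogonal projection `projHor` to `ℋ`. So `β` is a smooth
form. As `dh` annihilates `𝒱`, the field `X` is a section of `𝒰` and `β` is a section of `ℛ`
(`isCosectionOn_reaction`). A section `ξ_M` of `ℛ°` therefore satisfies `β(ξ_M) = 0`.

*Necessity.* Let `β` and `X` be local sections as in the definition of `ℛ`, and let `q ∈ M`. The
covector `α = β(q) + i_{X(q)} ω` annihilates `𝒱(q)`. The lifted action is free and proper, so that
there is an invariant function `h` with `dh(q) = α` (`exists_invariant_differential_eq`); it is
constructed on a slice. Since `X(q) ∈ ℋ` and `β(q)` annihilates `ℋ`, the vector `X(q)` is the value at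
`q` of the dynamical vector field of `h`. There is a solution of the system with Hamiltonian `h`
through `q` (`exists_isSolution`), and `𝐉^ξ` is constant along it. Hence
`0 = d𝐉^ξ(X(q)) = -ω(X(q), ξ_M(q)) = β(q)(ξ_M(q))`, where the last equality is `α(ξ_M(q)) = 0`. Only
one covector at a time has to be the differential of an invariant function, so that no quotient
manifold is needed.

Smoothness and the symplectic form are handled in the canonical cotangent charts. The maps `coordAt`
and `ofCoordAt` translate between tangent vectors and their components in a chart. In all these
charts `ω` has the same constant coefficients (`omega0_coordAt`), which makes the musical
isomorphism `ω^♯` smooth.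
-/

open scoped Topology

noncomputable section

namespace Nonholonomic

/-! ### Coordinates on tangent spaces -/

section General

variable {E : Type*} [NormedAddCommGroup E] [NormedSpace ℝ E]
  {H : Type*} [TopologicalSpace H] (I : ModelWithCorners ℝ E H)
  {P : Type*} [TopologicalSpace P] [ChartedSpace H P] [IsManifold I ∞ P]

/-- The coordinates of tangent vectors at `x` in the preferred chart at `x₀`. This is the junk
value `0` unless `x` is in the domain of that chart. -/
abbrev coordAt (x₀ x : P) : TangentSpace I x →L[ℝ] E :=
  (trivializationAt E (TangentSpace I) x₀).continuousLinearMapAt ℝ x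

/-- The tangent vector at `x` with given coordinates in the preferred chart at `x₀`, for `x` in
the domain of that chart. -/
abbrev ofCoordAt (x₀ x : P) : E →L[ℝ] TangentSpace I x :=
  (trivializationAt E (TangentSpace I) x₀).symmL ℝ x

variable {I}

theorem coordAt_ofCoordAt {x₀ x : P} (hx : x ∈ (extChartAt I x₀).source) (v : E) :
    coordAt I x₀ x (ofCoordAt I x₀ x v) = v :=
  (trivializationAt E (TangentSpace I) x₀).continuousLinearMapAt_symmL (by simpa using hx) v

theorem ofCoordAt_coordAt {x₀ x : P} (hx : x ∈ (extChartAt I x₀).source) (v : TangentSpace I x) :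
    ofCoordAt I x₀ x (coordAt I x₀ x v) = v :=
  (trivializationAt E (TangentSpace I) x₀).symmL_continuousLinearMapAt (by simpa using hx) v

/-- Mathlib identifies `T_xP` with the model space by the preferred chart at `x`. -/
theorem coordAt_self (x : P) (v : TangentSpace I x) : coordAt I x x v = v := by
  have h : coordAt I x x = _ := TangentBundle.continuousLinearMapAt_trivializationAt
    (mem_chart_source H x)
  rw [h]
  exact congrArg (fun L : TangentSpace I x →L[ℝ] E => L v) mfderiv_extChartAt_self

theorem ofCoordAt_self (x : P) (v : E) : ofCoordAt I x x v = v := by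
  rw [← coordAt_self x (ofCoordAt I x x v)]
  exact coordAt_ofCoordAt (mem_extChartAt_source x) v

/-- A vector field is smooth at `x₀` iff its components in the preferred chart at `x₀` are. -/
theorem contMDiffAt_vectorField_iff {X : ∀ x : P, TangentSpace I x} {x₀ : P} :
    ContMDiffAt I I.tangent ∞ (fun x => (⟨x, X x⟩ : TangentBundle I P)) x₀ ↔
      ContMDiffAt I 𝓘(ℝ, E) ∞ (fun x => coordAt I x₀ x (X x)) x₀ := by
  rw [contMDiffAt_section]
  refine Filter.EventuallyEq.contMDiffAt_iff ?_
  filter_upwards [extChartAt_source_mem_nhds (I := I) x₀] with x hx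
  rw [coordAt, Trivialization.continuousLinearMapAt_apply, Trivialization.coe_linearMapAt_of_mem]
  simpa using hx

/-- A `1`-form is smooth at `x₀` iff its components in the preferred chart at `x₀` are. -/
theorem contMDiffAt_oneForm_iff {β : ∀ x : P, TangentSpace I x →L[ℝ] ℝ} {x₀ : P} :
    ContMDiffAt I (I.prod 𝓘(ℝ, E →L[ℝ] ℝ)) ∞
      (fun x => TotalSpace.mk' (E := fun p : P => TangentSpace I p →L[ℝ] ℝ) (E →L[ℝ] ℝ) x (β x)) x₀ ↔
      ContMDiffAt I 𝓘(ℝ, E →L[ℝ] ℝ) ∞ (fun x => (β x).comp (ofCoordAt I x₀ x)) x₀ := by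
  rw [contMDiffAt_section]
  refine Filter.EventuallyEq.contMDiffAt_iff (Filter.Eventually.of_forall fun x => ?_)
  ext v
  simp [hom_trivializationAt_apply, ContinuousLinearMap.inCoordinates]

variable {E' : Type*} [NormedAddCommGroup E'] [NormedSpace ℝ E']
  {H' : Type*} [TopologicalSpace H'] {I' : ModelWithCorners ℝ E' H'}
  {P' : Type*} [TopologicalSpace P'] [ChartedSpace H' P'] [IsManifold I' ∞ P']

/-- The derivative of a map read in charts is the derivative of its coordinate expression. -/
theorem hasFDerivAt_coord [I.Boundaryless] {f : P → P'} {x x₀ : P} {y₀ : P'}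
    (hf : MDifferentiableAt I I' f x) (hx : x ∈ (extChartAt I x₀).source)
    (hy : f x ∈ (extChartAt I' y₀).source) :
    HasFDerivAt (extChartAt I' y₀ ∘ f ∘ (extChartAt I x₀).symm)
      ((coordAt I' y₀ (f x)).comp ((mfderiv I I' f x).comp (ofCoordAt I x₀ x)))
      (extChartAt I x₀ x) := by
  have hx' := hx
  have hy' := hy
  rw [extChartAt_source] at hx' hy'
  refine hasMFDerivAt_iff_hasFDerivAt.1 ?_
  have e1 : ofCoordAt I x₀ x = _ := TangentBundle.symmL_trivializationAt hx'
  have e2 : coordAt I' y₀ (f x) = _ := TangentBundle.continuousLinearMapAt_trivializationAt hy'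
  have hs : HasMFDerivAt 𝓘(ℝ, E) I (extChartAt I x₀).symm (extChartAt I x₀ x)
      (ofCoordAt I x₀ x : E →L[ℝ] TangentSpace I x) := by
    have := (mdifferentiableWithinAt_extChartAt_symm ((extChartAt I x₀).map_source hx)).hasMFDerivWithinAt
    rw [e1]
    rw [I.range_eq_univ] at *
    exact hasMFDerivWithinAt_univ.1 this
  have he : (extChartAt I x₀).symm (extChartAt I x₀ x) = x := (extChartAt I x₀).left_inv hx
  have hc : HasMFDerivAt I' 𝓘(ℝ, E') (extChartAt I' y₀) (f x) (coordAt I' y₀ (f x)) := by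
    rw [e2]
    exact (mdifferentiableAt_extChartAt hy').hasMFDerivAt
  have h1 : HasMFDerivAt I I' f ((extChartAt I x₀).symm (extChartAt I x₀ x)) (mfderiv I I' f x) := by
    rw [he]; exact hf.hasMFDerivAt
  have h2 := h1.comp _ hs
  have hc' : HasMFDerivAt I' 𝓘(ℝ, E') (extChartAt I' y₀)
      ((f ∘ (extChartAt I x₀).symm) (extChartAt I x₀ x)) (coordAt I' y₀ (f x)) := by
    rw [Function.comp_apply, he]; exact hc
  exact hc'.comp _ h2

variable (I) in
/-- The differential of a real function, as a `1`-form. -/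
def differential (f : P → ℝ) (x : P) : TangentSpace I x →L[ℝ] ℝ := mfderiv I 𝓘(ℝ, ℝ) f x

theorem contMDiffAt_differential {f : P → ℝ} {x₀ : P} (hf : ContMDiffAt I 𝓘(ℝ, ℝ) ∞ f x₀) :
    ContMDiffAt I (I.prod 𝓘(ℝ, E →L[ℝ] ℝ)) ∞
      (fun x => TotalSpace.mk' (E := fun p : P => TangentSpace I p →L[ℝ] ℝ) (E →L[ℝ] ℝ) x
        (differential I f x)) x₀ := by
  rw [contMDiffAt_oneForm_iff]
  have := hf.mfderiv_const (m := ∞) (by simp)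
  refine this.congr_of_eventuallyEq (Filter.Eventually.of_forall fun x => ?_)
  ext v
  simp [ContinuousLinearMap.inCoordinates, inTangentCoordinates]
  rfl

theorem hasFDerivAt_differential_coord [I.Boundaryless] {f : P → ℝ} {x x₀ : P}
    (hf : MDifferentiableAt I 𝓘(ℝ, ℝ) f x) (hx : x ∈ (extChartAt I x₀).source) :
    HasFDerivAt (f ∘ (extChartAt I x₀).symm) ((differential I f x).comp (ofCoordAt I x₀ x))
      (extChartAt I x₀ x) := by
  have h := hasFDerivAt_coord (y₀ := f x) hf hx (by simp)
  have h2 : (coordAt 𝓘(ℝ, ℝ) (f x) (f x)).comp ((mfderiv I 𝓘(ℝ, ℝ) f x).comp (ofCoordAt I x₀ x)) =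
      (differential I f x).comp (ofCoordAt I x₀ x) := by
    ext v
    exact coordAt_self (I := 𝓘(ℝ, ℝ)) (f x) _
  rw [← h2]
  simpa using! h

theorem hasDerivAt_coord_curve {c : ℝ → P} {t : ℝ} {v : TangentSpace I (c t)} {x₀ : P}
    (hc : HasMFDerivAt 𝓘(ℝ, ℝ) I c t (ContinuousLinearMap.toSpanSingleton ℝ v))
    (hx : c t ∈ (extChartAt I x₀).source) :
    HasDerivAt (extChartAt I x₀ ∘ c) (coordAt I x₀ (c t) v) t := by
  have hx' := hx
  rw [extChartAt_source] at hx'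
  have e2 : coordAt I x₀ (c t) = _ := TangentBundle.continuousLinearMapAt_trivializationAt hx'
  have hh : HasMFDerivAt I 𝓘(ℝ, E) (extChartAt I x₀) (c t) (coordAt I x₀ (c t)) := by
    rw [e2]
    exact (mdifferentiableAt_extChartAt hx').hasMFDerivAt
  have h3 : HasFDerivAt (extChartAt I x₀ ∘ c)
      (ContinuousLinearMap.toSpanSingleton ℝ (coordAt I x₀ (c t) v)) t := by
    have e : ContinuousLinearMap.toSpanSingleton ℝ (coordAt I x₀ (c t) v) =
        (coordAt I x₀ (c t)).comp (ContinuousLinearMap.toSpanSingleton ℝ v) := by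
      ext; simp
    rw [e]
    exact hasMFDerivAt_iff_hasFDerivAt.1 (hh.comp _ hc)
  simpa using h3.hasDerivAt

omit [IsManifold I ∞ P] in
theorem hasDerivAt_comp_curve {f : P → ℝ} {c : ℝ → P} {t : ℝ} {v : TangentSpace I (c t)}
    (hf : MDifferentiableAt I 𝓘(ℝ, ℝ) f (c t))
    (hc : HasMFDerivAt 𝓘(ℝ, ℝ) I c t (ContinuousLinearMap.toSpanSingleton ℝ v)) :
    HasDerivAt (f ∘ c) (differential I f (c t) v) t := by
  have h3 : HasFDerivAt (f ∘ c)
      (ContinuousLinearMap.toSpanSingleton ℝ (differential I f (c t) v)) t := by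
    have e : ContinuousLinearMap.toSpanSingleton ℝ (differential I f (c t) v) =
        (differential I f (c t)).comp (ContinuousLinearMap.toSpanSingleton ℝ v) := by
      ext; simp
    rw [e]
    exact hasMFDerivAt_iff_hasFDerivAt.1 (hf.hasMFDerivAt.comp _ hc)
  simpa using h3.hasDerivAt

end General

/-! ### Integral curves and infinitesimal actions -/

section IntegralCurves

variable {E : Type*} [NormedAddCommGroup E] [NormedSpace ℝ E]
  {H : Type*} [TopologicalSpace H] {I : ModelWithCorners ℝ E H}
  {P : Type*} [TopologicalSpace P] [ChartedSpace H P] [IsManifold I ∞ P]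

omit [IsManifold I ∞ P] in
theorem isMIntegralCurveAt_hasMFDerivAt {γ : ℝ → P} {X : ∀ x : P, TangentSpace I x} {t : ℝ}
    (h : IsMIntegralCurveAt γ X t) :
    HasMFDerivAt 𝓘(ℝ, ℝ) I γ t (ContinuousLinearMap.toSpanSingleton ℝ (X (γ t))) :=
  h.hasMFDerivAt

/-- Integral curves of smooth vector fields are smooth, by bootstrapping the differential
equation. -/
theorem contMDiffAt_integralCurve {γ : ℝ → P} {X : ∀ x : P, TangentSpace I x}
    (hX : ContMDiff I I.tangent ∞ (fun x => (⟨x, X x⟩ : TangentBundle I P)))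
    {t₀ : ℝ} (h : IsMIntegralCurveAt γ X t₀) : ContMDiffAt 𝓘(ℝ, ℝ) I ∞ γ t₀ := by
  -- `C^n` regularity is proved at all nearby times, for the induction to apply to the velocity
  suffices H : ∀ n : ℕ, ∀ t, IsMIntegralCurveAt γ X t → ContMDiffAt 𝓘(ℝ, ℝ) I n γ t from
    contMDiffAt_infty.2 fun n => H n t₀ h
  intro n
  induction n with
  | zero =>
    intro t ht
    have h1 : ∀ᶠ s in 𝓝 t, ContinuousAt γ s :=
      ht.mono fun s hs => hs.continuousAt
    obtain ⟨u, hu, hc⟩ := h1.exists_mem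
    have : ContMDiffOn 𝓘(ℝ, ℝ) I 0 γ u :=
      contMDiffOn_zero_iff.2 fun s hs => (hc s hs).continuousWithinAt
    exact this.contMDiffAt hu
  | succ n ih =>
    intro t ht
    rw [contMDiffAt_iff_target]
    refine ⟨ht.continuousAt, ?_⟩
    rw [contMDiffAt_iff_contDiffAt]
    have hsrc : ∀ᶠ s in 𝓝 t, γ s ∈ (extChartAt I (γ t)).source :=
      ht.continuousAt.preimage_mem_nhds (extChartAt_source_mem_nhds (I := I) _)
    have hd : ∀ᶠ s in 𝓝 t, HasFDerivAt (extChartAt I (γ t) ∘ γ)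
        (ContinuousLinearMap.toSpanSingleton ℝ (coordAt I (γ t) (γ s) (X (γ s)))) s := by
      filter_upwards [hsrc, ht] with s hs hs'
      exact (hasDerivAt_coord_curve hs' hs).hasFDerivAt
    obtain ⟨u, hu, hd⟩ := hd.exists_mem
    have hgoal : ContDiffAt ℝ ((n : WithTop ℕ∞) + 1) (extChartAt I (γ t) ∘ γ) t := by
      rw [contDiffAt_succ_iff_hasFDerivAt]
      refine ⟨_, ⟨u, hu, hd⟩, ?_⟩
      have h1 : ContMDiffAt 𝓘(ℝ, ℝ) 𝓘(ℝ, E) n (fun s => coordAt I (γ t) (γ s) (X (γ s))) t := by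
        have h2 := (contMDiffAt_vectorField_iff.1 hX.contMDiffAt).of_le
          (m := (n : WithTop ℕ∞)) (by exact_mod_cast le_top) (x := γ t)
        exact ContMDiffAt.comp t h2 (ih t ht)
      exact (ContinuousLinearMap.toSpanSingletonCLE (𝕜 := ℝ) (E := E)).contDiff.contDiffAt.comp t
        (contMDiffAt_iff_contDiffAt.1 h1)
    exact_mod_cast hgoal

end IntegralCurves

section Actions

variable {E : Type*} [NormedAddCommGroup E] [NormedSpace ℝ E]
  {H : Type*} [TopologicalSpace H] {I : ModelWithCorners ℝ E H}
  {P : Type*} [TopologicalSpace P] [ChartedSpace H P] [IsManifold I ∞ P]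
  {F : Type*} [NormedAddCommGroup F] [NormedSpace ℝ F]
  {G : Type*} [TopologicalSpace G] [ChartedSpace F G] [Group G] [LieGroup 𝓘(ℝ, F) ∞ G]
  [MulAction G P]

variable (F G I) in
/-- The infinitesimal action `𝔤 → T_pP`, the derivative at `1` of the orbit map. (Its values lie in
the tangent space at `1 • p = p`.) -/
def infinitesimalAction (p : P) : GroupLieAlgebra 𝓘(ℝ, F) G →L[ℝ] TangentSpace I p :=
  mfderiv 𝓘(ℝ, F) I (fun g : G => g • p) 1

omit [IsManifold I ∞ P] [LieGroup 𝓘(ℝ, F) ∞ G] in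
theorem contMDiff_orbitMap
    (hsmooth : ContMDiff (𝓘(ℝ, F).prod I) I ∞ (fun x : G × P => x.1 • x.2)) (p : P) :
    ContMDiff 𝓘(ℝ, F) I ∞ (fun g : G => g • p) :=
  hsmooth.comp (contMDiff_id.prodMk contMDiff_const)

omit [IsManifold I ∞ P] [LieGroup 𝓘(ℝ, F) ∞ G] in
theorem contMDiff_translate
    (hsmooth : ContMDiff (𝓘(ℝ, F).prod I) I ∞ (fun x : G × P => x.1 • x.2)) (g : G) :
    ContMDiff I I ∞ (fun p : P => g • p) :=
  hsmooth.comp (contMDiff_const.prodMk contMDiff_id)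

omit [IsManifold I ∞ P] [LieGroup 𝓘(ℝ, F) ∞ G] in
theorem hasMFDerivAt_orbitMap
    (hsmooth : ContMDiff (𝓘(ℝ, F).prod I) I ∞ (fun x : G × P => x.1 • x.2)) (p : P) :
    HasMFDerivAt 𝓘(ℝ, F) I (fun g : G => g • p) 1 (infinitesimalAction I F G p) :=
  ((contMDiff_orbitMap hsmooth p).mdifferentiable (by simp) 1).hasMFDerivAt

omit [IsManifold I ∞ P] [LieGroup 𝓘(ℝ, F) ∞ G] in
/-- The differential of a function that is constant on the orbit of `p` annihilates the tangent
space of the orbit. -/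
theorem differential_infinitesimalAction_eq_zero
    (hsmooth : ContMDiff (𝓘(ℝ, F).prod I) I ∞ (fun x : G × P => x.1 • x.2)) {f : P → ℝ} {p : P}
    (hf : MDifferentiableAt I 𝓘(ℝ, ℝ) f p) (hfp : ∀ g : G, f (g • p) = f p)
    (ξ : GroupLieAlgebra 𝓘(ℝ, F) G) : differential I f p (infinitesimalAction I F G p ξ) = 0 := by
  have h1 : HasMFDerivAt I 𝓘(ℝ, ℝ) f ((1 : G) • p) (differential I f p) := by
    rw [one_smul]; exact hf.hasMFDerivAt
  have h2 := h1.comp (1 : G) (hasMFDerivAt_orbitMap (F := F) hsmooth p)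
  have h3 : f ∘ (fun g : G => g • p) = fun _ => f p := funext hfp
  rw [h3] at h2
  exact congrArg (fun L => L ξ) (hasMFDerivAt_unique h2 (hasMFDerivAt_const (f p) (1 : G)))

omit [IsManifold I ∞ P] in
/-- Equality in the tangent bundle at base points that are equal, but not definitionally. -/
theorem tangentBundle_mk_eq {x y : P} (h : x = y) (v : TangentSpace I x) (w : TangentSpace I y)
    (hvw : (show E from v) = w) : (⟨x, v⟩ : TangentBundle I P) = ⟨y, w⟩ := by
  subst h
  exact congrArg _ hvw

/-- Infinitesimal generators are smooth: the generator of `ξ` is the derivative of the action map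
applied to the smooth vector field `(ξ, 0)` along `{1} × P`. -/
theorem contMDiff_infinitesimalAction
    (hsmooth : ContMDiff (𝓘(ℝ, F).prod I) I ∞ (fun x : G × P => x.1 • x.2))
    (ξ : GroupLieAlgebra 𝓘(ℝ, F) G) :
    ContMDiff I I.tangent ∞
      (fun p => (⟨p, infinitesimalAction I F G p ξ⟩ : TangentBundle I P)) := by
  -- `p ↦ (ξ, 0)`, followed by the tangent map of the action
  let fξ : P → TangentBundle 𝓘(ℝ, F) G := fun _ => ⟨1, ξ⟩
  let f0 : P → TangentBundle I P := fun p => TotalSpace.mk' E p 0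
  have s0 : ContMDiff I I.tangent ∞ f0 := contMDiff_zeroSection _ _
  have sξ : ContMDiff I (𝓘(ℝ, F)).tangent ∞ fξ := contMDiff_const
  have S₁ := sξ.prodMk s0
  have S₂ : ContMDiff _ _ ∞ (equivTangentBundleProd 𝓘(ℝ, F) G I P).symm :=
    contMDiff_equivTangentBundleProd_symm
  have S₃ : ContMDiff _ _ ∞ (tangentMap (𝓘(ℝ, F).prod I) I (fun x : G × P => x.1 • x.2)) :=
    hsmooth.contMDiff_tangentMap (m := ∞) (by simp)
  have S := (S₃.comp S₂).comp S₁
  convert! S using 1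
  funext p
  refine (tangentBundle_mk_eq (one_smul G p) _ _ ?_).symm
  have hd : MDifferentiableAt (𝓘(ℝ, F).prod I) I (fun x : G × P => x.1 • x.2) (1, p) :=
    hsmooth.mdifferentiable (by simp) _
  have := mfderiv_prod_eq_add_apply hd (v := (show TangentSpace (𝓘(ℝ, F).prod I) ((1 : G), p) from
    ((ξ : F), (0 : E))))
  refine this.trans ?_
  show mfderiv 𝓘(ℝ, F) I (fun g : G => g • p) 1 ξ +
    (mfderiv I I (fun x : P => (1 : G) • x) p) (0 : TangentSpace I p) = _
  rw [map_zero, add_zero]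
  rfl

/-- The infinitesimal action of a free action is injective: if `ξ_P(p) = 0` then the integral
curve through `1` of the left invariant vector field of `ξ` fixes `p`, hence is constant. -/
theorem infinitesimalAction_injective [FiniteDimensional ℝ F] [I.Boundaryless]
    (hsmooth : ContMDiff (𝓘(ℝ, F).prod I) I ∞ (fun x : G × P => x.1 • x.2))
    (hfree : ∀ (g : G) (p : P), g • p = p → g = 1) (p : P) :
    Function.Injective (infinitesimalAction I F G p) := by
  refine (injective_iff_map_eq_zero _).2 fun ξ hξ => ?_
  have : LieGroup 𝓘(ℝ, F) (minSmoothness ℝ 3) G :=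
    LieGroup.of_le (n := ∞) (by simpa using ENat.LEInfty.out)
  have : CompleteSpace F := FiniteDimensional.complete ℝ F
  have hv := (contMDiff_mulInvariantVectorField (I := 𝓘(ℝ, F)) (G := G) ξ)
  have hv1 : ContMDiffAt 𝓘(ℝ, F) 𝓘(ℝ, F).tangent 1
      (fun g : G => (mulInvariantVectorField ξ g : TangentBundle 𝓘(ℝ, F) G)) 1 :=
    (hv.of_le (by simp)).contMDiffAt
  obtain ⟨γ, hγ0, hγ⟩ := exists_isMIntegralCurveAt_of_contMDiffAt_boundaryless (t₀ := 0) hv1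
  have horb := contMDiff_orbitMap (F := F) (G := G) hsmooth p
  -- by equivariance, left translates of `ξ` are in the kernel of the derivative of the orbit map
  have key : ∀ g : G, mfderiv 𝓘(ℝ, F) I (fun g : G => g • p) g (mulInvariantVectorField ξ g) = 0 := by
    intro g
    have hm : HasMFDerivAt 𝓘(ℝ, F) 𝓘(ℝ, F) (fun x : G => g * x) 1
        (mfderiv 𝓘(ℝ, F) 𝓘(ℝ, F) (fun x : G => g * x) 1) :=
      ((contMDiff_mul_left (n := ∞)).mdifferentiable (by simp) 1).hasMFDerivAt
    have ho : HasMFDerivAt 𝓘(ℝ, F) I (fun g : G => g • p) (g * 1)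
        (mfderiv 𝓘(ℝ, F) I (fun g : G => g • p) g) := by
      rw [mul_one]
      exact (horb.mdifferentiable (by simp) g).hasMFDerivAt
    have h1 := ho.comp (1 : G) hm
    have ht : HasMFDerivAt I I (fun x : P => g • x) ((1 : G) • p)
        (mfderiv I I (fun x : P => g • x) p) := by
      rw [one_smul]
      exact ((contMDiff_translate hsmooth g).mdifferentiable (by simp) p).hasMFDerivAt
    have h2 := ht.comp (1 : G) (hasMFDerivAt_orbitMap hsmooth p)
    have he : (fun g : G => g • p) ∘ (fun x : G => g * x) =
        (fun x : P => g • x) ∘ (fun g : G => g • p) := by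
      funext x; exact mul_smul g x p
    rw [he] at h1
    have h3 := hasMFDerivAt_unique h1 h2
    have h4 := congrArg (fun L => L ξ) h3
    refine h4.trans ?_
    show mfderiv I I (fun x : P => g • x) p (infinitesimalAction I F G p ξ) = 0
    rw [hξ, map_zero]
  -- so `t ↦ γ t • p` is an integral curve of the zero field, as is the constant curve
  have hc : IsMIntegralCurveAt (fun t => γ t • p) (fun x : P => (0 : TangentSpace I x)) 0 := by
    filter_upwards [hγ] with t ht
    have := ((horb.mdifferentiable (by simp) (γ t)).hasMFDerivAt).comp t ht
    have e : ((1 : ℝ →L[ℝ] ℝ).smulRight (0 : TangentSpace I (γ t • p))) =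
        (mfderiv 𝓘(ℝ, F) I (fun g : G => g • p) (γ t)).comp
          ((1 : ℝ →L[ℝ] ℝ).smulRight (mulInvariantVectorField ξ (γ t))) := by
      ext
      show (1 : ℝ) • (0 : TangentSpace I (γ t • p)) =
        mfderiv 𝓘(ℝ, F) I (fun g : G => g • p) (γ t)
          ((1 : ℝ) • mulInvariantVectorField ξ (γ t))
      rw [one_smul, one_smul, key]
    rw [e]
    exact this
  have hc' : IsMIntegralCurveAt (fun _ : ℝ => p) (fun x : P => (0 : TangentSpace I x)) 0 := by
    refine Filter.Eventually.of_forall fun t => ?_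
    have e : ((1 : ℝ →L[ℝ] ℝ).smulRight (0 : TangentSpace I p)) = 0 := by ext; simp
    rw [e]
    exact hasMFDerivAt_const (I := 𝓘(ℝ, ℝ)) (I' := I) p t
  have heq := isMIntegralCurveAt_eventuallyEq_of_contMDiffAt_boundaryless
    (contMDiff_zeroSection ℝ (fun x : P => TangentSpace I x)).contMDiffAt hc hc'
    (by rw [hγ0, one_smul])
  have hγ1 : γ =ᶠ[𝓝 0] fun _ => 1 := heq.mono fun t ht => hfree _ _ ht
  have h5 : HasMFDerivAt 𝓘(ℝ, ℝ) 𝓘(ℝ, F) γ 0 0 :=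
    (hasMFDerivAt_const (1 : G) (0 : ℝ)).congr_of_eventuallyEq hγ1
  have h6 := hasMFDerivAt_unique hγ.hasMFDerivAt h5
  have h7 : (1 : ℝ) • mulInvariantVectorField ξ (γ 0) = 0 := congrArg (fun L => L (1 : ℝ)) h6
  rw [one_smul, hγ0] at h7
  have h8 : mulInvariantVectorField ξ (1 : G) = ξ := by
    unfold mulInvariantVectorField
    have : (fun x : G => 1 * x) = id := by funext x; simp
    rw [this]
    exact congrArg (fun L => L ξ) (mfderiv_id (I := 𝓘(ℝ, F)) (x := (1 : G)))
  rw [← h8]; exact h7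

end Actions

/-! ### Slices of free proper actions -/

section Slice

variable {E : Type*} [NormedAddCommGroup E] [NormedSpace ℝ E] [FiniteDimensional ℝ E]
  {H : Type*} [TopologicalSpace H] {I : ModelWithCorners ℝ E H} [I.Boundaryless]
  {P : Type*} [TopologicalSpace P] [ChartedSpace H P] [IsManifold I ∞ P]
  {F : Type*} [NormedAddCommGroup F] [NormedSpace ℝ F] [FiniteDimensional ℝ F]
  {G : Type*} [TopologicalSpace G] [ChartedSpace F G] [Group G] [LieGroup 𝓘(ℝ, F) ∞ G]
  [MulAction G P]

/-- For a free proper action, group elements that do not move a small neighbourhood of `p` off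
itself are close to `1`. -/
theorem exists_nhds_return {G P : Type*} [TopologicalSpace G] [Group G] [TopologicalSpace P]
    [MulAction G P] [ProperSMul G P] (hfree : ∀ (g : G) (p : P), g • p = p → g = 1)
    (p : P) {V : Set G} (hV : V ∈ 𝓝 (1 : G)) :
    ∃ O ∈ 𝓝 p, ∀ (g : G), ∀ x ∈ O, g • x ∈ O → g ∈ V := by
  have hcl : IsClosedMap (fun x : G × P => (x.1 • x.2, x.2)) :=
    ProperSMul.isProperMap_smul_pair.isClosedMap
  have hC := hcl ((interior V)ᶜ ×ˢ univ) (isOpen_interior.isClosed_compl.prod isClosed_univ)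
  have hp : (p, p) ∈ ((fun x : G × P => (x.1 • x.2, x.2)) '' ((interior V)ᶜ ×ˢ univ))ᶜ := by
    rintro ⟨⟨g, x⟩, ⟨hg, -⟩, hgx⟩
    simp only [Prod.mk.injEq] at hgx
    obtain ⟨h1, rfl⟩ := hgx
    rw [hfree g x h1] at hg
    exact hg (mem_interior_iff_mem_nhds.2 hV)
  have hn := hC.isOpen_compl.mem_nhds hp
  rw [nhds_prod_eq, Filter.mem_prod_self_iff] at hn
  obtain ⟨O, hO, hsub⟩ := hn
  refine ⟨O, hO, fun g x hx hgx => ?_⟩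
  by_contra hg
  exact hsub (mk_mem_prod hgx hx) ⟨(g, x), ⟨fun h => hg (interior_subset h), mem_univ _⟩, rfl⟩

variable (I) in
/-- The affine slice through `p` in the preferred chart at `p`, in the directions `N`. -/
def slice (p : P) (N : Submodule ℝ E) (n : N) : P :=
  (extChartAt I p).symm (extChartAt I p p + n)

/-- A free proper smooth action has a slice at every point: in a chart, a small ball in a
complement `N` of the tangent space of the orbit meets every orbit at most once, and near the slice
the `N`-coordinate of the orbit is a smooth function. -/
theorem exists_slice [ProperSMul G P]
    (hsmooth : ContMDiff (𝓘(ℝ, F).prod I) I ∞ (fun x : G × P => x.1 • x.2))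
    (hfree : ∀ (g : G) (p : P), g • p = p → g = 1) (p : P) :
    ∃ (N : Submodule ℝ E) (r : ℝ), 0 < r ∧
      (∀ v : E, ∃ (ξ : GroupLieAlgebra 𝓘(ℝ, F) G) (n : N),
        v = (show E from infinitesimalAction I F G p ξ) + n) ∧
      (∀ n : N, ‖n‖ < r → extChartAt I p p + n ∈ (extChartAt I p).target) ∧
      (∀ (g g' : G) (n n' : N), ‖n‖ < r → ‖n'‖ < r → g • slice I p N n = g' • slice I p N n' →
        n = n') ∧
      ∀ n : N, ‖n‖ < r → ∃ σ : P → N, ContMDiffAt I 𝓘(ℝ, N) ∞ σ (slice I p N n) ∧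
        ∀ᶠ y in 𝓝 (slice I p N n), ‖σ y‖ < r ∧ ∃ g : G, y = g • slice I p N (σ y) := by
  let a : F →L[ℝ] E := infinitesimalAction I F G p
  have ha : Function.Injective a := infinitesimalAction_injective hsmooth hfree p
  obtain ⟨N, hN⟩ := Submodule.exists_isCompl (LinearMap.range (a : F →ₗ[ℝ] E))
  set e := extChartAt I p with he
  set χ := extChartAt 𝓘(ℝ, F) (1 : G) with hχ
  have heo : IsOpen e.target := isOpen_extChartAt_target p
  have hχo : IsOpen χ.target := isOpen_extChartAt_target (1 : G)
  have heso : IsOpen e.source := isOpen_extChartAt_source p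
  have hep : p ∈ e.source := mem_extChartAt_source p
  have hχ1 : (1 : G) ∈ χ.source := mem_extChartAt_source 1
  -- the parametrization `Φ (u, n) = χ⁻¹(u) • s n` by the group and the slice, and its expression `Ψ`
  -- in the chart `e`
  let s : N → P := slice I p N
  have hs0 : s 0 = p := by simp [s, slice]
  let Φ : F × N → P := fun z => χ.symm z.1 • s z.2
  let Ψ : F × N → E := fun z => e (Φ z)
  let z₀ : F × N := (χ 1, 0)
  have hΦz : ∀ n, Φ (χ 1, n) = s n := fun n => by
    simp only [Φ]; rw [χ.left_inv hχ1, one_smul]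
  -- smoothness of the parametrizations
  have hs : ∀ n : N, e p + n ∈ e.target → ContMDiffAt 𝓘(ℝ, N) I ∞ s n := by
    intro n hn
    have h1 : ContMDiffAt 𝓘(ℝ, E) I ∞ e.symm (e p + n) :=
      (contMDiffOn_extChartAt_symm p).contMDiffAt (heo.mem_nhds hn)
    have h2 : ContDiff ℝ ∞ (fun n : N => e p + (n : E)) :=
      contDiff_const.add N.subtypeL.contDiff
    exact ContMDiffAt.comp n h1 h2.contDiffAt.contMDiffAt
  have hΦ : ∀ z : F × N, z.1 ∈ χ.target → e p + z.2 ∈ e.target →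
      ContMDiffAt 𝓘(ℝ, F × N) I ∞ Φ z := by
    intro z hz1 hz2
    have h1 : ContMDiffAt 𝓘(ℝ, F) 𝓘(ℝ, F) ∞ χ.symm z.1 :=
      (contMDiffOn_extChartAt_symm (1 : G)).contMDiffAt (hχo.mem_nhds hz1)
    have h3 : ContMDiffAt 𝓘(ℝ, F × N) 𝓘(ℝ, F) ∞ (fun z : F × N => χ.symm z.1) z :=
      ContMDiffAt.comp z h1 contDiff_fst.contDiffAt.contMDiffAt
    have h4 : ContMDiffAt 𝓘(ℝ, F × N) I ∞ (fun z : F × N => s z.2) z :=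
      ContMDiffAt.comp (g := s) (f := Prod.snd) z (hs z.2 hz2) contDiff_snd.contDiffAt.contMDiffAt
    exact ContMDiffAt.comp z hsmooth.contMDiffAt (h3.prodMk h4)
  have hΨ : ∀ z : F × N, z.1 ∈ χ.target → e p + z.2 ∈ e.target → Φ z ∈ e.source →
      ContDiffAt ℝ ∞ Ψ z := by
    intro z hz1 hz2 hz3
    rw [← contMDiffAt_iff_contDiffAt]
    have h1 : ContMDiffAt I 𝓘(ℝ, E) ∞ e (Φ z) :=
      contMDiffAt_extChartAt' (by rwa [he, extChartAt_source] at hz3)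
    exact ContMDiffAt.comp z h1 (hΦ z hz1 hz2)
  have hz01 : z₀.1 ∈ χ.target := χ.map_source hχ1
  have hz02 : e p + z₀.2 ∈ e.target := by simpa [z₀] using e.map_source hep
  have hΦz0 : Φ z₀ = p := by rw [hΦz, hs0]
  have hz03 : Φ z₀ ∈ e.source := by rw [hΦz0]; exact hep
  have hΨ0 := hΨ z₀ hz01 hz02 hz03
  -- the derivative at the centre is the isomorphism `F × N ≃ E`
  let L : F × N →L[ℝ] E := a.coprod N.subtypeL
  have hL : HasFDerivAt Ψ L z₀ := by
    have h0 := (hΨ0.differentiableAt (by simp)).hasFDerivAt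
    have : fderiv ℝ Ψ z₀ = L := by
      refine ContinuousLinearMap.ext fun w => ?_
      have e1 : HasFDerivAt (fun u : F => Ψ (u, 0)) ((fderiv ℝ Ψ z₀).comp
          (ContinuousLinearMap.inl ℝ F N)) (χ 1) :=
        HasFDerivAt.comp (g := Ψ) (χ 1) h0 (hasFDerivAt_prodMk_left (𝕜 := ℝ) (χ 1) (0 : N))
      have e2 : HasFDerivAt (fun u : F => Ψ (u, 0)) a (χ 1) := by
        have hor := (hasMFDerivAt_orbitMap (F := F) (G := G) hsmooth p)
        have h5 := hasFDerivAt_coord (x₀ := (1 : G)) (y₀ := p) hor.mdifferentiableAt hχ1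
          (by rw [one_smul]; exact hep)
        have h6 : (coordAt I p ((1 : G) • p)).comp ((mfderiv 𝓘(ℝ, F) I (fun g : G => g • p) 1).comp
            (ofCoordAt 𝓘(ℝ, F) (1 : G) 1)) = a := by
          refine ContinuousLinearMap.ext fun u => ?_
          show coordAt I p ((1 : G) • p) (mfderiv 𝓘(ℝ, F) I (fun g : G => g • p) 1
            (ofCoordAt 𝓘(ℝ, F) (1 : G) 1 u)) = a u
          rw [ofCoordAt_self]
          have h7 : ∀ x : P, x = p → ∀ v : TangentSpace I x, (coordAt I p x v : E) = v := by
            rintro x rfl v; exact coordAt_self x v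
          exact h7 _ (one_smul G p) _
        rw [h6] at h5
        refine h5.congr_of_eventuallyEq (Filter.Eventually.of_forall fun u => ?_)
        simp only [Ψ, Φ, hs0]
        rfl
      have e3 : HasFDerivAt (fun n : N => Ψ (χ 1, n)) ((fderiv ℝ Ψ z₀).comp
          (ContinuousLinearMap.inr ℝ F N)) 0 :=
        HasFDerivAt.comp (g := Ψ) 0 h0 (hasFDerivAt_prodMk_right (𝕜 := ℝ) (χ 1) (0 : N))
      have e4 : HasFDerivAt (fun n : N => Ψ (χ 1, n)) N.subtypeL 0 := by
        have h5 : HasFDerivAt (fun n : N => e p + (n : E)) N.subtypeL 0 :=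
          N.subtypeL.hasFDerivAt.const_add (e p)
        refine h5.congr_of_eventuallyEq ?_
        have hc : ContinuousAt (fun n : N => e p + (n : E)) 0 := by fun_prop
        filter_upwards [hc.preimage_mem_nhds (heo.mem_nhds (by simpa using e.map_source hep))]
          with n hn
        simp only [Ψ, hΦz]
        exact e.right_inv hn
      have e5 := DFunLike.congr_fun (e1.unique e2) w.1
      have e6 := DFunLike.congr_fun (e3.unique e4) w.2
      have e7 : w = ContinuousLinearMap.inl ℝ F N w.1 + ContinuousLinearMap.inr ℝ F N w.2 := by
        simp
      rw [e7, map_add, map_add]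
      congr 1
      · exact e5.trans (by simp [L])
      · exact e6.trans (by simp [L])
    rwa [← this]
  have hLbij : Function.Bijective L := by
    have hd := hN.disjoint
    have hc := hN.codisjoint
    constructor
    · refine (injective_iff_map_eq_zero _).2 fun w hw => ?_
      have hw' : a w.1 = -(w.2 : E) := eq_neg_of_add_eq_zero_left (by simpa [L] using hw)
      have h1 : a w.1 ∈ N := by rw [hw']; exact N.neg_mem w.2.2
      have h2 : a w.1 = 0 := by
        have := Submodule.disjoint_def.1 hd (a w.1) ⟨w.1, rfl⟩ h1
        exact this
      have h3 : w.1 = 0 := ha (by rw [h2, map_zero])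
      have h4 : w.2 = 0 := by
        rw [h2] at hw'
        exact Subtype.ext (neg_eq_zero.1 hw'.symm)
      exact Prod.ext h3 h4
    · intro v
      have : v ∈ LinearMap.range (a : F →ₗ[ℝ] E) ⊔ N := by
        rw [hc.eq_top]; trivial
      obtain ⟨_, ⟨u, rfl⟩, n, hn, rfl⟩ := Submodule.mem_sup.1 this
      exact ⟨(u, ⟨n, hn⟩), by simp [L]⟩
  let Le : (F × N) ≃L[ℝ] E := (LinearEquiv.ofBijective (L : F × N →ₗ[ℝ] E) hLbij).toContinuousLinearEquiv
  have hLe : (Le : F × N →L[ℝ] E) = L := by ext <;> rfl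
  have : CompleteSpace (F × N) := FiniteDimensional.complete ℝ (F × N)
  have hLe' : HasFDerivAt Ψ (Le : F × N →L[ℝ] E) z₀ := by rw [hLe]; exact hL
  -- the chart whose coordinates are a group element near `1` and a point of the slice
  let Θ := hΨ0.toOpenPartialHomeomorph Ψ hLe' (by simp)
  have hΘ : ∀ z, Θ z = Ψ z := fun z => rfl
  have hz0Θ : z₀ ∈ Θ.source := hΨ0.mem_toOpenPartialHomeomorph_source hLe' (by simp)
  -- a neighbourhood of the centre on which everything is well behaved
  have hΦc : ContinuousAt Φ z₀ := (hΦ z₀ hz01 hz02).continuousAt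
  have hW : ∀ᶠ z in 𝓝 z₀, z ∈ Θ.source ∧ z.1 ∈ χ.target ∧ e p + z.2 ∈ e.target ∧ Φ z ∈ e.source ∧
      ∃ M : (F × N) ≃L[ℝ] E, HasFDerivAt Ψ (M : F × N →L[ℝ] E) z := by
    have h1 : ContinuousAt (fun z : F × N => z.1) z₀ := by fun_prop
    have h2 : ContinuousAt (fun z : F × N => e p + (z.2 : E)) z₀ := by fun_prop
    have h3 : ContinuousAt (fderiv ℝ Ψ) z₀ := (hΨ0.fderiv_right (m := 0) (by simp)).continuousAt
    have h4 : ∀ᶠ z in 𝓝 z₀, fderiv ℝ Ψ z ∈ range ((↑) : ((F × N) ≃L[ℝ] E) → F × N →L[ℝ] E) := by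
      refine h3.preimage_mem_nhds ?_
      rw [hLe'.fderiv]
      exact ContinuousLinearEquiv.nhds Le
    have h5 : ∀ᶠ z in 𝓝 z₀, DifferentiableAt ℝ Ψ z := by
      have : ContDiffAt ℝ 1 Ψ z₀ := hΨ0.of_le (by simp)
      exact (this.eventually (by simp)).mono fun z hz => hz.differentiableAt (by simp)
    filter_upwards [Θ.open_source.mem_nhds hz0Θ, h1.preimage_mem_nhds (hχo.mem_nhds hz01),
      h2.preimage_mem_nhds (heo.mem_nhds hz02), hΦc.preimage_mem_nhds (heso.mem_nhds hz03), h4, h5]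
      with z a1 a2 a3 a4 a5 a6
    obtain ⟨M, hM⟩ := a5
    exact ⟨a1, a2, a3, a4, M, by rw [hM]; exact a6.hasFDerivAt⟩
  obtain ⟨δ, hδ, hball⟩ := Metric.eventually_nhds_iff_ball.1 hW
  have hball' : ∀ (u : F) (n : N), dist u (χ 1) < δ → ‖n‖ < δ → (u, n) ∈ Metric.ball z₀ δ := by
    intro u n hu hn
    rw [Metric.mem_ball, Prod.dist_eq, max_lt_iff]
    exact ⟨hu, by simpa [z₀, dist_zero_right] using hn⟩
  have hV : χ.source ∩ χ ⁻¹' Metric.ball (χ 1) δ ∈ 𝓝 (1 : G) :=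
    Filter.inter_mem (extChartAt_source_mem_nhds _)
      ((continuousAt_extChartAt (1 : G)).preimage_mem_nhds (Metric.ball_mem_nhds _ hδ))
  -- properness: only group elements in the range of `Θ` return the slice to itself
  obtain ⟨O, hO, hret⟩ := exists_nhds_return hfree p hV
  have hsc : ContinuousAt s 0 := (hs 0 (by simpa using e.map_source hep)).continuousAt
  have hsO : ∀ᶠ n in 𝓝 (0 : N), s n ∈ O := hsc.preimage_mem_nhds (by rwa [hs0])
  obtain ⟨δ', hδ', hballO⟩ := Metric.eventually_nhds_iff_ball.1 hsO
  have hr1 : ∀ n : N, ‖n‖ < min δ δ' → ‖n‖ < δ := fun n hn => hn.trans_le (min_le_left _ _)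
  have hr2 : ∀ n : N, ‖n‖ < min δ δ' → s n ∈ O := fun n hn =>
    hballO n (by simpa [dist_zero_right] using hn.trans_le (min_le_right _ _))
  have hχδ : dist (χ 1) (χ 1) < δ := by simpa using hδ
  refine ⟨N, min δ δ', lt_min hδ hδ', ?_, ?_, ?_, ?_⟩
  · intro v
    obtain ⟨w, hw⟩ := hLbij.2 v
    refine ⟨w.1, w.2, ?_⟩
    rw [← hw]
    show a.coprod N.subtypeL w = a w.1 + w.2
    simp
  · intro n hn
    exact (hball _ (hball' (χ 1) n hχδ (hr1 n hn))).2.2.1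
  · intro g g' n n' hn hn' hgg
    have h1 : (g'⁻¹ * g) • s n = s n' := by rw [mul_smul, hgg, inv_smul_smul]
    have h2 := hret (g'⁻¹ * g) (s n) (hr2 n hn) (by rw [h1]; exact hr2 n' hn')
    have h3 := hball _ (hball' (χ (g'⁻¹ * g)) n h2.2 (hr1 n hn))
    have h4 := hball _ (hball' (χ 1) n' hχδ (hr1 n' hn'))
    have h5 : Ψ (χ (g'⁻¹ * g), n) = Ψ (χ 1, n') := by
      simp only [Ψ, hΦz]
      congr 1
      simp only [Φ]
      rw [χ.left_inv h2.1, h1]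
    exact congrArg Prod.snd (Θ.injOn h3.1 h4.1 h5)
  · intro n hn
    obtain ⟨b1, b2, b3, b4, M, hM⟩ := hball _ (hball' (χ 1) n hχδ (hr1 n hn))
    have hsn : s n ∈ e.source := by rw [← hΦz]; exact b4
    have hesn : e (s n) = Θ (χ 1, n) := by rw [hΘ]; simp only [Ψ, hΦz]
    have hinv : Θ.symm (e (s n)) = (χ 1, n) := by rw [hesn]; exact Θ.left_inv b1
    have htar : e (s n) ∈ Θ.target := by rw [hesn]; exact Θ.map_source b1
    have hsymm : ContDiffAt ℝ ∞ Θ.symm (e (s n)) :=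
      Θ.contDiffAt_symm htar (f₀' := M) (by rw [hinv]; exact hM)
        (by rw [hinv]; exact hΨ _ b2 b3 b4)
    have hec : ContMDiffAt I 𝓘(ℝ, E) ∞ e (s n) :=
      contMDiffAt_extChartAt' (by rwa [he, extChartAt_source] at hsn)
    have hcomp : ContMDiffAt I 𝓘(ℝ, F × N) ∞ (fun y => Θ.symm (e y)) (s n) :=
      ContMDiffAt.comp (s n) hsymm.contMDiffAt hec
    refine ⟨fun y => (Θ.symm (e y)).2, ContMDiffAt.comp (s n)
      contDiff_snd.contDiffAt.contMDiffAt hcomp, ?_⟩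
    have hWo : IsOpen {z : F × N | z ∈ Metric.ball z₀ δ ∧ ‖z.2‖ < min δ δ'} :=
      Metric.isOpen_ball.inter (isOpen_lt (continuous_norm.comp continuous_snd) continuous_const)
    filter_upwards [heso.mem_nhds hsn, hec.continuousAt.preimage_mem_nhds (Θ.open_target.mem_nhds htar),
      hcomp.continuousAt.preimage_mem_nhds (hWo.mem_nhds
        (by rw [hinv]; exact ⟨hball' (χ 1) n hχδ (hr1 n hn), hn⟩))] with y c1 c2 c3
    refine ⟨c3.2, χ.symm (Θ.symm (e y)).1, ?_⟩
    obtain ⟨-, d2, d3, d4, -⟩ := hball _ c3.1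
    have h8 : e (Φ (Θ.symm (e y))) = e y := Θ.right_inv c2
    exact (e.injOn d4 c1 h8).symm

end Slice

/-! ### Invariant functions with prescribed differential -/

section InvariantFunctions

variable {E : Type*} [NormedAddCommGroup E] [NormedSpace ℝ E] [FiniteDimensional ℝ E]
  {H : Type*} [TopologicalSpace H] {I : ModelWithCorners ℝ E H} [I.Boundaryless]
  {P : Type*} [TopologicalSpace P] [ChartedSpace H P] [IsManifold I ∞ P]
  {F : Type*} [NormedAddCommGroup F] [NormedSpace ℝ F] [FiniteDimensional ℝ F]
  {G : Type*} [TopologicalSpace G] [ChartedSpace F G] [Group G] [LieGroup 𝓘(ℝ, F) ∞ G]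
  [MulAction G P]

open scoped Pointwise in
/-- A covector that annihilates the tangent space of the orbit of a free proper action is the
differential of an invariant function: extend a cut-off linear function on the slice to be
constant along orbits, and by zero. -/
theorem exists_invariant_differential_eq [ProperSMul G P]
    (hsmooth : ContMDiff (𝓘(ℝ, F).prod I) I ∞ (fun x : G × P => x.1 • x.2))
    (hfree : ∀ (g : G) (p : P), g • p = p → g = 1) (p : P) (α : TangentSpace I p →L[ℝ] ℝ)
    (hα : ∀ ξ, α (infinitesimalAction I F G p ξ) = 0) :
    ∃ h : P → ℝ, ContMDiff I 𝓘(ℝ, ℝ) ∞ h ∧ (∀ (g : G) (x : P), h (g • x) = h x) ∧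
      differential I h p = α := by
  obtain ⟨N, r, hr, hspan, htar, hinj, hσ⟩ := exists_slice hsmooth hfree p
  set s : N → P := slice I p N with hs
  set e := extChartAt I p with he
  let α' : E →L[ℝ] ℝ := α
  let ρ : ContDiffBump (0 : N) := ⟨r / 4, r / 2, by linarith, by linarith⟩
  let f : N → ℝ := fun n => ρ n * α' n
  have hf : ContDiff ℝ ∞ f := ρ.contDiff.mul (α'.comp N.subtypeL).contDiff
  have hf0 : ∀ n : N, r / 2 < ‖n‖ → f n = 0 := fun n hn => by
    have : ρ n = 0 := ρ.zero_of_le_dist (by rw [dist_zero_right]; exact hn.le)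
    simp [f, this]
  have hs0 : s 0 = p := by simp [hs, slice]
  classical
  -- the value on an orbit that meets the slice is read off at the point of intersection
  let h : P → ℝ := fun x =>
    if hx : ∃ n : N, ‖n‖ < r ∧ ∃ g : G, x = g • s n then f hx.choose else 0
  have hval : ∀ (g : G) (n : N), ‖n‖ < r → h (g • s n) = f n := by
    intro g n hn
    have hx : ∃ n' : N, ‖n'‖ < r ∧ ∃ g' : G, g • s n = g' • s n' := ⟨n, hn, g, rfl⟩
    have h1 : h (g • s n) = f hx.choose := dif_pos hx
    obtain ⟨h2, g', h3⟩ := hx.choose_spec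
    rw [h1, ← hinj g g' n _ hn h2 h3]
  have hnot : ∀ x, (¬ ∃ n : N, ‖n‖ < r ∧ ∃ g : G, x = g • s n) → h x = 0 := fun x hx => dif_neg hx
  have hinv : ∀ (g : G) (x : P), h (g • x) = h x := by
    intro g x
    by_cases hx : ∃ n : N, ‖n‖ < r ∧ ∃ g : G, x = g • s n
    · obtain ⟨n, hn, g', rfl⟩ := hx
      rw [← mul_smul, hval _ _ hn, hval _ _ hn]
    · rw [hnot x hx, hnot]
      rintro ⟨n, hn, g', hg'⟩
      exact hx ⟨n, hn, g⁻¹ * g', by rw [mul_smul, ← hg', inv_smul_smul]⟩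
  have hsmoothS : ∀ n : N, ‖n‖ < r → ContMDiffAt I 𝓘(ℝ, ℝ) ∞ h (s n) := by
    intro n hn
    obtain ⟨σ, h1, h2⟩ := hσ n hn
    have h3 : ContMDiffAt I 𝓘(ℝ, ℝ) ∞ (fun y => f (σ y)) (s n) :=
      ContMDiffAt.comp (g := f) (s n) hf.contDiffAt.contMDiffAt h1
    refine h3.congr_of_eventuallyEq (h2.mono fun y hy => ?_)
    obtain ⟨hy1, g, hy2⟩ := hy
    show h y = f (σ y)
    conv_lhs => rw [hy2]
    exact hval g _ hy1
  have hsc : ∀ n : N, ‖n‖ < r → ContinuousAt s n := by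
    intro n hn
    have h1 : ContinuousAt e.symm (e p + n) := continuousAt_extChartAt_symm'' (htar n hn)
    have h2 : ContinuousAt (fun n : N => e p + (n : E)) n := by fun_prop
    exact ContinuousAt.comp (g := e.symm) h1 h2
  have hh : ContMDiff I 𝓘(ℝ, ℝ) ∞ h := by
    intro x
    by_cases hx : ∃ n : N, ‖n‖ < r ∧ ∃ g : G, x = g • s n
    · obtain ⟨n, hn, g, rfl⟩ := hx
      have h1 : h = fun y => h (g⁻¹ • y) := by funext y; rw [hinv]
      rw [h1]
      have h2 : ContMDiffAt I 𝓘(ℝ, ℝ) ∞ h (g⁻¹ • g • s n) := by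
        rw [inv_smul_smul]; exact hsmoothS n hn
      exact ContMDiffAt.comp (g := h) (g • s n) h2 (contMDiff_translate hsmooth g⁻¹).contMDiffAt
    · -- off the saturation of the slice, `h` vanishes outside a closed saturated set
      have hK : IsCompact (s '' Metric.closedBall 0 (r / 2)) := by
        refine (isCompact_closedBall (0 : N) (r / 2)).image_of_continuousOn fun n hn => ?_
        refine (hsc n ?_).continuousWithinAt
        rw [Metric.mem_closedBall, dist_zero_right] at hn
        linarith
      have hC : IsClosed ((univ : Set G) • (s '' Metric.closedBall 0 (r / 2))) :=
        isClosed_univ.smul_right_of_isCompact hK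
      have hxC : x ∉ (univ : Set G) • (s '' Metric.closedBall 0 (r / 2)) := by
        rintro ⟨g, -, _, ⟨n, hn, rfl⟩, rfl⟩
        rw [Metric.mem_closedBall, dist_zero_right] at hn
        exact hx ⟨n, by linarith, g, rfl⟩
      refine (contMDiffAt_const (c := (0 : ℝ))).congr_of_eventuallyEq ?_
      filter_upwards [hC.isOpen_compl.mem_nhds hxC] with y hy
      by_cases hy' : ∃ n : N, ‖n‖ < r ∧ ∃ g : G, y = g • s n
      · obtain ⟨n, hn, g, rfl⟩ := hy'
        rw [hval g n hn]
        refine hf0 n (lt_of_not_ge fun hle => hy ?_)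
        exact ⟨g, mem_univ _, s n, ⟨n, by simpa [dist_zero_right] using hle, rfl⟩, rfl⟩
      · exact hnot y hy'
  refine ⟨h, hh, hinv, ContinuousLinearMap.ext fun v => ?_⟩
  have hd : MDifferentiableAt I 𝓘(ℝ, ℝ) h p := hh.mdifferentiable (by simp) p
  -- both sides vanish on the tangent space of the orbit
  have horb : ∀ ξ, differential I h p (infinitesimalAction I F G p ξ) = 0 :=
    differential_infinitesimalAction_eq_zero hsmooth hd fun g => hinv g p
  -- both sides agree along the slice
  have hsl : ∀ n : N, differential I h p (show TangentSpace I p from (n : E)) = α' n := by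
    intro n
    have h1 := hasFDerivAt_differential_coord hd (mem_extChartAt_source p)
    have h1' : HasFDerivAt (h ∘ e.symm) ((differential I h p).comp (ofCoordAt I p p))
        (e p + ((0 : N) : E)) := by
      rw [Submodule.coe_zero, add_zero]; exact h1
    have h2 : HasFDerivAt (fun n : N => e p + (n : E)) N.subtypeL 0 :=
      N.subtypeL.hasFDerivAt.const_add (e p)
    have h3 := HasFDerivAt.comp (g := h ∘ e.symm) (f := fun n : N => e p + (n : E)) 0 h1' h2
    have h4 : HasFDerivAt ((h ∘ e.symm) ∘ fun n : N => e p + (n : E)) (α'.comp N.subtypeL) 0 := by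
      refine (α'.comp N.subtypeL).hasFDerivAt.congr_of_eventuallyEq ?_
      filter_upwards [ρ.eventuallyEq_one, Metric.ball_mem_nhds (0 : N) hr] with n hn1 hn2
      have h5 := hval 1 n (by simpa [dist_zero_right] using hn2)
      rw [one_smul] at h5
      show h (s n) = α' n
      rw [h5]
      simp [f, hn1]
    have h6 := DFunLike.congr_fun (h3.unique h4) n
    refine Eq.trans ?_ h6
    show _ = differential I h p (ofCoordAt I p p (n : E))
    exact congrArg (differential I h p) (ofCoordAt_self p (n : E)).symm
  obtain ⟨ξ, n, hv⟩ := hspan v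
  have hv' : v = infinitesimalAction I F G p ξ + (show TangentSpace I p from (n : E)) := hv
  rw [hv', map_add, map_add, horb, hα, hsl]
  rfl

end InvariantFunctions

/-! ### The symplectic form on the model space -/

section Calculus

variable (E : Type*) [NormedAddCommGroup E] [NormedSpace ℝ E]

/-! Shortcut instances for the dual of `E × E*`, on which instance search is slow. -/

instance instNormedAddCommGroupDual : NormedAddCommGroup ((E × (E →L[ℝ] ℝ)) →L[ℝ] ℝ) :=
  ContinuousLinearMap.toNormedAddCommGroup

instance instAddCommGroupDual : AddCommGroup ((E × (E →L[ℝ] ℝ)) →L[ℝ] ℝ) :=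
  ContinuousLinearMap.addCommGroup

instance instIsTopologicalAddGroupDual : IsTopologicalAddGroup ((E × (E →L[ℝ] ℝ)) →L[ℝ] ℝ) :=
  inferInstance

/-- The constant symplectic form `((δq, δp), (δq', δp')) ↦ δp' (δq) - δp (δq')` on `E × E*`. -/
def omega0 : (E × (E →L[ℝ] ℝ)) →L[ℝ] (E × (E →L[ℝ] ℝ)) →L[ℝ] ℝ :=
  let B : (E × (E →L[ℝ] ℝ)) →L[ℝ] (E × (E →L[ℝ] ℝ)) →L[ℝ] ℝ :=
    (ContinuousLinearMap.id ℝ (E →L[ℝ] ℝ)).bilinearComp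
      (ContinuousLinearMap.snd ℝ E (E →L[ℝ] ℝ)) (ContinuousLinearMap.fst ℝ E (E →L[ℝ] ℝ))
  B.flip - B

variable {E}

theorem omega0_apply (v w : E × (E →L[ℝ] ℝ)) : omega0 E v w = w.2 v.1 - v.2 w.1 := by
  simp [omega0]

/-- The cotangent lift `k` of a local diffeomorphism `τ` preserves the symplectic form. -/
theorem omega0_cotangentLift {k : E × (E →L[ℝ] ℝ) → E × (E →L[ℝ] ℝ)} {τ : E → E}
    {A : (E × (E →L[ℝ] ℝ)) →L[ℝ] E × (E →L[ℝ] ℝ)} {z₀ : E × (E →L[ℝ] ℝ)}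
    (hk : HasFDerivAt k A z₀) (hτ : ContDiffAt ℝ ∞ τ z₀.1)
    (h : ∀ᶠ z in 𝓝 z₀, (k z).1 = τ z.1 ∧ (k z).2.comp (fderiv ℝ τ z.1) = z.2)
    (v w : E × (E →L[ℝ] ℝ)) : omega0 E (A v) (A w) = omega0 E v w := by
  have hfst : HasFDerivAt (fun z : E × (E →L[ℝ] ℝ) => z.1) (ContinuousLinearMap.fst ℝ E (E →L[ℝ] ℝ)) z₀ :=
    hasFDerivAt_fst
  have hτ1 : HasFDerivAt τ (fderiv ℝ τ z₀.1) z₀.1 := (hτ.differentiableAt (by simp)).hasFDerivAt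
  have hτ2 : HasFDerivAt (fderiv ℝ τ) (fderiv ℝ (fderiv ℝ τ) z₀.1) z₀.1 :=
    ((hτ.fderiv_right (m := ∞) (by simp)).differentiableAt (by simp)).hasFDerivAt
  have h1 : ∀ v, (A v).1 = fderiv ℝ τ z₀.1 v.1 := by
    have e1 := hk.fst
    have e2 := HasFDerivAt.comp (g := τ) z₀ hτ1 hfst
    have e3 := e2.congr_of_eventuallyEq (h.mono fun z hz => hz.1)
    exact fun v => DFunLike.congr_fun (e1.unique e3) v
  have h2 : ∀ v a, (A v).2 (fderiv ℝ τ z₀.1 a) + (k z₀).2 (fderiv ℝ (fderiv ℝ τ) z₀.1 v.1 a) = v.2 a := by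
    have e1 := hk.snd
    have e2 := HasFDerivAt.comp (g := fderiv ℝ τ) z₀ hτ2 hfst
    have e3 := e1.clm_comp e2
    have e4 : HasFDerivAt (fun z : E × (E →L[ℝ] ℝ) => z.2) (ContinuousLinearMap.snd ℝ E (E →L[ℝ] ℝ)) z₀ :=
      hasFDerivAt_snd
    have e5 := e4.congr_of_eventuallyEq (h.mono fun z hz => hz.2)
    intro v a
    have e6 := DFunLike.congr_fun (DFunLike.congr_fun (e3.unique e5) v) a
    simpa [add_comm] using e6
  have hsymm : IsSymmSndFDerivAt ℝ τ z₀.1 := hτ.isSymmSndFDerivAt (by simp; exact ENat.LEInfty.out)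
  rw [omega0_apply, omega0_apply, h1, h1]
  have e1 := h2 v w.1
  have e2 := h2 w v.1
  have e3 : fderiv ℝ (fderiv ℝ τ) z₀.1 v.1 w.1 = fderiv ℝ (fderiv ℝ τ) z₀.1 w.1 v.1 := hsymm _ _
  rw [e3] at e1
  linarith

theorem eq_zero_of_omega0_eq_zero {v : E × (E →L[ℝ] ℝ)} (hv : ∀ w, omega0 E v w = 0) : v = 0 := by
  have h : ∀ w : E × (E →L[ℝ] ℝ), w.2 v.1 - v.2 w.1 = 0 := fun w => by
    rw [← omega0_apply, hv]
  refine Prod.ext ?_ ?_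
  · by_contra hne
    obtain ⟨f, -, hf⟩ := exists_dual_vector ℝ v.1 (norm_ne_zero_iff.2 hne)
    have := h (0, f)
    simp [hf] at this
    exact hne this
  · ext x
    have := h (x, 0)
    simpa using this

theorem omega0_injective : Function.Injective (omega0 E) := by
  intro v w h
  refine sub_eq_zero.1 (eq_zero_of_omega0_eq_zero fun u => ?_)
  have h1 := DFunLike.congr_fun h u
  rw [omega0_apply, omega0_apply] at h1
  rw [omega0_apply, Prod.fst_sub, Prod.snd_sub, map_sub, sub_apply]
  linarith

variable [FiniteDimensional ℝ E]

variable (E) in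
/-- The isomorphism `v ↦ i_v ω` from `E × E*` to its dual. -/
def flatEquiv : (E × (E →L[ℝ] ℝ)) ≃L[ℝ] ((E × (E →L[ℝ] ℝ)) →L[ℝ] ℝ) :=
  (LinearMap.linearEquivOfInjective (omega0 E : (E × (E →L[ℝ] ℝ)) →ₗ[ℝ] _) omega0_injective
    (by
      rw [← (LinearMap.toContinuousLinearMap (𝕜 := ℝ) (E := E × (E →L[ℝ] ℝ)) (F' := ℝ)).finrank_eq]
      exact (Subspace.dual_finrank_eq).symm)).toContinuousLinearEquiv

/-- The vector `ω^♯ γ` with `i_{ω^♯ γ} ω = γ`. -/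
def sharp (γ : (E × (E →L[ℝ] ℝ)) →L[ℝ] ℝ) : E × (E →L[ℝ] ℝ) := (flatEquiv E).symm γ

theorem omega0_sharp (γ : (E × (E →L[ℝ] ℝ)) →L[ℝ] ℝ) : omega0 E (sharp γ) = γ :=
  (flatEquiv E).apply_symm_apply γ

end Calculus
variable {E : Type*} [NormedAddCommGroup E] [NormedSpace ℝ E] [FiniteDimensional ℝ E]
variable {Q : Type*} [TopologicalSpace Q] [ChartedSpace E Q] [IsManifold 𝓘(ℝ, E) ∞ Q]


omit [FiniteDimensional ℝ E] in
instance t2Space_cot [T2Space Q] : T2Space (Cot E Q) := by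
  refine ⟨fun x y hxy => ?_⟩
  by_cases h : x.proj = y.proj
  · let t := trivializationAt (E →L[ℝ] ℝ) (fun q : Q => TangentSpace 𝓘(ℝ, E) q →L[ℝ] ℝ) x.proj
    have hx : x ∈ t.source := FiberBundle.mem_trivializationAt_proj_source
    have hy : y ∈ t.source := by
      rw [t.mem_source, ← h]; exact FiberBundle.mem_baseSet_trivializationAt' _
    have hne : t x ≠ t y := fun he => hxy (t.injOn hx hy he)
    obtain ⟨U, V, hU, hV, hxU, hyV, hUV⟩ := t2_separation hne
    refine ⟨_, _, t.toOpenPartialHomeomorph.isOpen_inter_preimage hU,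
      t.toOpenPartialHomeomorph.isOpen_inter_preimage hV, ⟨hx, hxU⟩, ⟨hy, hyV⟩, ?_⟩
    exact (hUV.preimage t).mono inter_subset_right inter_subset_right
  · exact separated_by_continuous (FiberBundle.continuous_proj (E →L[ℝ] ℝ) _) h

/-! ### Canonical charts of the cotangent bundle -/

section CotangentCharts

variable {E : Type*} [NormedAddCommGroup E] [NormedSpace ℝ E]
variable {Q : Type*} [TopologicalSpace Q] [ChartedSpace E Q] [IsManifold 𝓘(ℝ, E) ∞ Q]

/-- The charts of `T*Q` are the canonical cotangent charts. -/
theorem extChartAt_cot (p₀ p : Cot E Q) :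
    extChartAt (cotModel E) p₀ p = (extChartAt 𝓘(ℝ, E) p₀.proj p.proj,
      p.2.comp (ofCoordAt 𝓘(ℝ, E) p₀.proj p.proj)) := by
  rw [FiberBundle.extChartAt]
  refine Prod.ext rfl ?_
  ext v
  simp [hom_trivializationAt_apply, ContinuousLinearMap.inCoordinates]

theorem mem_extChartAt_cot_source {p₀ p : Cot E Q} :
    p ∈ (extChartAt (cotModel E) p₀).source ↔ p.proj ∈ (extChartAt 𝓘(ℝ, E) p₀.proj).source := by
  rw [extChartAt_source, extChartAt_source, FiberBundle.chartedSpace_chartAt]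
  simp only [OpenPartialHomeomorph.trans_source, mem_inter_iff, mem_preimage]
  simp
  exact fun h => h

theorem contMDiff_cot_proj :
    ContMDiff (cotModel E) 𝓘(ℝ, E) ∞ (fun p : Cot E Q => p.proj) :=
  contMDiff_proj _

/-- In charts, pulling back covectors by `f` is composition with the derivative of the coordinate
expression of `f`. -/
theorem coord_covector_comp_fderiv {f : Q → Q} {x q₀ q₁ : Q}
    (hf : MDifferentiableAt 𝓘(ℝ, E) 𝓘(ℝ, E) f x)
    (hx : x ∈ (extChartAt 𝓘(ℝ, E) q₁).source) (hfx : f x ∈ (extChartAt 𝓘(ℝ, E) q₀).source)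
    (P : TangentSpace 𝓘(ℝ, E) (f x) →L[ℝ] ℝ) :
    (P.comp (ofCoordAt 𝓘(ℝ, E) q₀ (f x))).comp
      (fderiv ℝ (extChartAt 𝓘(ℝ, E) q₀ ∘ f ∘ (extChartAt 𝓘(ℝ, E) q₁).symm)
        (extChartAt 𝓘(ℝ, E) q₁ x)) =
    (P.comp (mfderiv 𝓘(ℝ, E) 𝓘(ℝ, E) f x)).comp (ofCoordAt 𝓘(ℝ, E) q₁ x) := by
  rw [(hasFDerivAt_coord hf hx hfx).fderiv]
  refine ContinuousLinearMap.ext fun v => ?_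
  exact congrArg P (ofCoordAt_coordAt hfx _)

/-- The canonical symplectic form has constant coefficients in every canonical cotangent chart,
because coordinate changes between these are cotangent lifts. -/
theorem omega0_coordAt {p₀ p : Cot E Q} (hp : p ∈ (extChartAt (cotModel E) p₀).source)
    (v w : TCot p) :
    omega0 E (coordAt (cotModel E) p₀ p v) (coordAt (cotModel E) p₀ p w) = omegaCan p v w := by
  have h1 := hasFDerivAt_coord (f := fun x : Cot E Q => x) (x := p) (x₀ := p) (y₀ := p₀)
    (mdifferentiableAt_id (I := cotModel E)) (mem_extChartAt_source p) hp
  have hv : ∀ v : E × (E →L[ℝ] ℝ), ((coordAt (cotModel E) p₀ p).comp ((mfderiv (cotModel E) (cotModel E)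
      (fun x : Cot E Q => x) p).comp (ofCoordAt (cotModel E) p p))) v = coordAt (cotModel E) p₀ p v := by
    intro v
    show coordAt (cotModel E) p₀ p (mfderiv (cotModel E) (cotModel E)
      (fun x : Cot E Q => x) p (ofCoordAt (cotModel E) p p v)) = _
    rw [ofCoordAt_self]
    exact congrArg (coordAt (cotModel E) p₀ p)
      (congrArg (fun L : TCot p →L[ℝ] TCot p => L v) (mfderiv_id (I := cotModel E) (x := p)))
  rw [← hv v, ← hv w]
  have hp' : p.proj ∈ (extChartAt 𝓘(ℝ, E) p₀.proj).source := mem_extChartAt_cot_source.1 hp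
  set φ₀ := extChartAt 𝓘(ℝ, E) p₀.proj with hφ₀
  set φ := extChartAt 𝓘(ℝ, E) p.proj with hφ
  have hpp : p.proj ∈ φ.source := mem_extChartAt_source _
  refine (omega0_cotangentLift (τ := φ₀ ∘ (fun x : Q => x) ∘ φ.symm) h1 ?_ ?_ v w)
  · have e1 : (extChartAt (cotModel E) p p).1 = φ p.proj := by rw [extChartAt_cot]
    rw [e1, ← contMDiffAt_iff_contDiffAt]
    have e2 : ContMDiffAt 𝓘(ℝ, E) 𝓘(ℝ, E) ∞ φ.symm (φ p.proj) :=
      (contMDiffOn_extChartAt_symm p.proj).contMDiffAt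
        ((isOpen_extChartAt_target p.proj).mem_nhds (φ.map_source hpp))
    have e3 : ContMDiffAt 𝓘(ℝ, E) 𝓘(ℝ, E) ∞ φ₀ (φ.symm (φ p.proj)) := by
      rw [φ.left_inv hpp]
      exact contMDiffAt_extChartAt' (by rwa [hφ₀, extChartAt_source] at hp')
    exact ContMDiffAt.comp (g := φ₀) _ e3 e2
  · have ht : (extChartAt (cotModel E) p).target ∈ 𝓝 (extChartAt (cotModel E) p p) :=
      extChartAt_target_mem_nhds p
    have hs : (extChartAt (cotModel E) p).symm ⁻¹' (extChartAt (cotModel E) p₀).source ∈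
        𝓝 (extChartAt (cotModel E) p p) :=
      (continuousAt_extChartAt_symm p).preimage_mem_nhds
        ((isOpen_extChartAt_source p₀).mem_nhds (by rwa [extChartAt_to_inv]))
    filter_upwards [ht, hs] with z hz hz0
    obtain ⟨x, hx, rfl⟩ : ∃ x ∈ (extChartAt (cotModel E) p).source, extChartAt (cotModel E) p x = z :=
      ⟨_, (extChartAt (cotModel E) p).map_target hz, (extChartAt (cotModel E) p).right_inv hz⟩
    simp only [mem_preimage, Function.comp_apply] at hz0 ⊢
    rw [(extChartAt (cotModel E) p).left_inv hx] at hz0 ⊢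
    rw [extChartAt_cot, extChartAt_cot]
    have hxp := mem_extChartAt_cot_source.1 hx
    have hxp0 := mem_extChartAt_cot_source.1 hz0
    refine ⟨?_, ?_⟩
    · show φ₀ x.proj = φ₀ (φ.symm (φ x.proj))
      rw [φ.left_inv hxp]
    · refine (coord_covector_comp_fderiv (f := fun x : Q => x) (mdifferentiableAt_id (I := 𝓘(ℝ, E)))
        hxp hxp0 x.2).trans ?_
      refine ContinuousLinearMap.ext fun v => ?_
      show x.2 (mfderiv 𝓘(ℝ, E) 𝓘(ℝ, E) (fun x : Q => x) x.proj
        (ofCoordAt 𝓘(ℝ, E) p.proj x.proj v)) = x.2 (ofCoordAt 𝓘(ℝ, E) p.proj x.proj v)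
      refine congrArg x.2 ?_
      exact (congrArg (fun L : TangentSpace 𝓘(ℝ, E) x.proj →L[ℝ] TangentSpace 𝓘(ℝ, E) x.proj =>
        L (ofCoordAt 𝓘(ℝ, E) p.proj x.proj v)) (mfderiv_id (I := 𝓘(ℝ, E)) (x := x.proj)))

theorem omegaCan_apply {p : Cot E Q} (v w : E × (E →L[ℝ] ℝ)) :
    omegaCan p v w = w.2 v.1 - v.2 w.1 :=
  omega0_apply v w

theorem coordAt_tangentProj {p₀ p : Cot E Q} (hp : p ∈ (extChartAt (cotModel E) p₀).source)
    (v : E × (E →L[ℝ] ℝ)) :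
    coordAt 𝓘(ℝ, E) p₀.proj p.proj (tangentProj p (ofCoordAt (cotModel E) p₀ p v)) = v.1 := by
  have hp' := mem_extChartAt_cot_source.1 hp
  have h1 := hasFDerivAt_coord (f := fun x : Cot E Q => x.proj) (x := p) (x₀ := p₀) (y₀ := p₀.proj)
    (contMDiff_cot_proj.mdifferentiable (by simp) p) hp hp'
  have h2 : HasFDerivAt (extChartAt 𝓘(ℝ, E) p₀.proj ∘ (fun x : Cot E Q => x.proj) ∘
      (extChartAt (cotModel E) p₀).symm) (ContinuousLinearMap.fst ℝ E (E →L[ℝ] ℝ))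
      (extChartAt (cotModel E) p₀ p) := by
    refine hasFDerivAt_fst.congr_of_eventuallyEq ?_
    filter_upwards [(isOpen_extChartAt_target p₀).mem_nhds
      ((extChartAt (cotModel E) p₀).map_source hp)] with z hz
    have h3 := congrArg Prod.fst ((extChartAt (cotModel E) p₀).right_inv hz)
    rw [extChartAt_cot] at h3
    exact h3
  exact DFunLike.congr_fun (h1.unique h2) v

theorem tangentProj_apply (p : Cot E Q) (v : E × (E →L[ℝ] ℝ)) :
    (tangentProj p v : E) = v.1 := by
  have h := coordAt_tangentProj (mem_extChartAt_source p) v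
  rw [coordAt_self, ofCoordAt_self] at h
  exact h

end CotangentCharts

/-! ### The cotangent lift of a smooth action -/

section Lift

variable {E : Type*} [NormedAddCommGroup E] [NormedSpace ℝ E]
variable {Q : Type*} [TopologicalSpace Q] [ChartedSpace E Q] [IsManifold 𝓘(ℝ, E) ∞ Q]
variable {F : Type*} [NormedAddCommGroup F] [NormedSpace ℝ F]
variable {G : Type*} [TopologicalSpace G] [ChartedSpace F G] [Group G] [LieGroup 𝓘(ℝ, F) ∞ G]
  [MulAction G Q]

/-- Smoothness of a map to `T*Q`, in the canonical cotangent chart. -/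
theorem contMDiffAt_cot_iff {EM : Type*} [NormedAddCommGroup EM] [NormedSpace ℝ EM]
    {HM : Type*} [TopologicalSpace HM] {IM : ModelWithCorners ℝ EM HM}
    {M : Type*} [TopologicalSpace M] [ChartedSpace HM M] {f : M → Cot E Q} {x₀ : M} :
    ContMDiffAt IM (cotModel E) ∞ f x₀ ↔ ContMDiffAt IM 𝓘(ℝ, E) ∞ (fun x => (f x).proj) x₀ ∧
      ContMDiffAt IM 𝓘(ℝ, E →L[ℝ] ℝ) ∞
        (fun x => (f x).2.comp (ofCoordAt 𝓘(ℝ, E) (f x₀).proj (f x).proj)) x₀ := by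
  rw [contMDiffAt_hom_bundle]
  refine and_congr Iff.rfl
    (Filter.EventuallyEq.contMDiffAt_iff (Filter.Eventually.of_forall fun x => ?_))
  ext v
  simp [ContinuousLinearMap.inCoordinates]

omit [IsManifold 𝓘(ℝ, E) ∞ Q] in
/-- Equality in `T*Q` at base points that are equal, but not definitionally. -/
theorem cot_mk_eq {x y : Q} (h : x = y) (v : TangentSpace 𝓘(ℝ, E) x →L[ℝ] ℝ)
    (w : TangentSpace 𝓘(ℝ, E) y →L[ℝ] ℝ) (hvw : (show E →L[ℝ] ℝ from v) = w) :
    (⟨x, v⟩ : Cot E Q) = ⟨y, w⟩ := by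
  subst h
  exact congrArg _ hvw

/-- The tangent map of the action with its source and target identified with the model space, so
that base points may be rewritten. -/
def modelTangentAct (g : G) (q : Q) : E →L[ℝ] E := tangentAct (E := E) g q

omit [IsManifold 𝓘(ℝ, E) ∞ Q] [TopologicalSpace G] in
theorem lift_eq (g : G) (p : Cot E Q) : lift g p = ⟨g • p.proj,
    show E →L[ℝ] ℝ from
      (show E →L[ℝ] ℝ from p.2).comp (modelTangentAct g⁻¹ (g • p.proj))⟩ := rfl

omit [IsManifold 𝓘(ℝ, E) ∞ Q] [LieGroup 𝓘(ℝ, F) ∞ G] in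
theorem hasMFDerivAt_act
    (hsmooth : ContMDiff (𝓘(ℝ, F).prod 𝓘(ℝ, E)) 𝓘(ℝ, E) ∞ (fun x : G × Q => x.1 • x.2))
    (g : G) (q : Q) :
    HasMFDerivAt 𝓘(ℝ, E) 𝓘(ℝ, E) (fun x : Q => g • x) q (tangentAct g q) :=
  ((contMDiff_translate hsmooth g).mdifferentiable (by simp) q).hasMFDerivAt

omit [IsManifold 𝓘(ℝ, E) ∞ Q] [TopologicalSpace G] in
theorem modelTangentAct_one (q : Q) : modelTangentAct (E := E) (1 : G) q = .id ℝ E := by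
  have h : (fun x : Q => (1 : G) • x) = id := by funext x; simp
  unfold modelTangentAct tangentAct
  rw [h]
  exact mfderiv_id

omit [IsManifold 𝓘(ℝ, E) ∞ Q] [LieGroup 𝓘(ℝ, F) ∞ G] in
theorem modelTangentAct_mul
    (hsmooth : ContMDiff (𝓘(ℝ, F).prod 𝓘(ℝ, E)) 𝓘(ℝ, E) ∞ (fun x : G × Q => x.1 • x.2))
    (g h : G) (q : Q) : modelTangentAct (E := E) (g * h) q =
      (modelTangentAct g (h • q)).comp (modelTangentAct h q) := by
  have h1 := (hasMFDerivAt_act hsmooth g (h • q)).comp q (hasMFDerivAt_act hsmooth h q)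
  have h2 : (fun x : Q => g • x) ∘ (fun x : Q => h • x) = fun x : Q => (g * h) • x := by
    funext x; exact (mul_smul g h x).symm
  rw [h2] at h1
  exact hasMFDerivAt_unique (hasMFDerivAt_act hsmooth (g * h) q) h1

omit [IsManifold 𝓘(ℝ, E) ∞ Q] [LieGroup 𝓘(ℝ, F) ∞ G] in
/-- `Φ_g(p) ∘ T_qφ_g = p`, which characterizes the cotangent lift. -/
theorem lift_apply_tangentAct
    (hsmooth : ContMDiff (𝓘(ℝ, F).prod 𝓘(ℝ, E)) 𝓘(ℝ, E) ∞ (fun x : G × Q => x.1 • x.2))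
    (g : G) (p : Cot E Q) (v : TangentSpace 𝓘(ℝ, E) p.proj) :
    (lift g p).2 (tangentAct g p.proj v) = p.2 v := by
  show (show E →L[ℝ] ℝ from p.2) (modelTangentAct g⁻¹ (g • p.proj) (modelTangentAct g p.proj v)) = _
  have h := modelTangentAct_mul hsmooth g⁻¹ g p.proj
  rw [inv_mul_cancel, modelTangentAct_one] at h
  exact congrArg _ (DFunLike.congr_fun h v).symm

omit [IsManifold 𝓘(ℝ, E) ∞ Q] [TopologicalSpace G] in
theorem lift_one (p : Cot E Q) : lift (1 : G) p = p := by
  rw [lift_eq]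
  refine cot_mk_eq (one_smul G _) _ _ ?_
  rw [inv_one, modelTangentAct_one]
  rfl

omit [IsManifold 𝓘(ℝ, E) ∞ Q] [LieGroup 𝓘(ℝ, F) ∞ G] in
theorem lift_mul
    (hsmooth : ContMDiff (𝓘(ℝ, F).prod 𝓘(ℝ, E)) 𝓘(ℝ, E) ∞ (fun x : G × Q => x.1 • x.2))
    (g h : G) (p : Cot E Q) : lift (g * h) p = lift g (lift h p) := by
  rw [lift_eq, lift_eq g]
  refine cot_mk_eq (mul_smul g h _) _ _ ?_
  show (show E →L[ℝ] ℝ from p.2).comp (modelTangentAct (g * h)⁻¹ ((g * h) • p.proj)) =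
    ((show E →L[ℝ] ℝ from p.2).comp (modelTangentAct h⁻¹ (h • p.proj))).comp
      (modelTangentAct g⁻¹ (g • h • p.proj))
  rw [mul_inv_rev, modelTangentAct_mul hsmooth, mul_smul, inv_smul_smul]
  rfl

/-- The cotangent lift of a smooth action, as an action. -/
abbrev liftAction
    (hsmooth : ContMDiff (𝓘(ℝ, F).prod 𝓘(ℝ, E)) 𝓘(ℝ, E) ∞ (fun x : G × Q => x.1 • x.2)) :
    MulAction G (Cot E Q) where
  smul := lift
  one_smul := lift_one
  mul_smul := lift_mul hsmooth

/-- The cotangent lift of a smooth action is smooth: in charts, the tangent map of the action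
depends smoothly on the group element and the base point. -/
theorem contMDiff_lift
    (hsmooth : ContMDiff (𝓘(ℝ, F).prod 𝓘(ℝ, E)) 𝓘(ℝ, E) ∞ (fun x : G × Q => x.1 • x.2)) :
    ContMDiff (𝓘(ℝ, F).prod (cotModel E)) (cotModel E) ∞
      (fun x : G × Cot E Q => lift x.1 x.2) := by
  intro x₀
  have hproj : ContMDiff (𝓘(ℝ, F).prod (cotModel E)) 𝓘(ℝ, E) ∞
      (fun x : G × Cot E Q => x.2.proj) := contMDiff_cot_proj.comp contMDiff_snd
  have hbase : ContMDiff (𝓘(ℝ, F).prod (cotModel E)) 𝓘(ℝ, E) ∞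
      (fun x : G × Cot E Q => x.1 • x.2.proj) := hsmooth.comp (contMDiff_fst.prodMk hproj)
  have hinv : ContMDiff ((𝓘(ℝ, F).prod (cotModel E)).prod 𝓘(ℝ, E)) 𝓘(ℝ, E) ∞
      (fun y : (G × Cot E Q) × Q => y.1.1⁻¹ • y.2) := by
    have h1 : ContMDiff ((𝓘(ℝ, F).prod (cotModel E)).prod 𝓘(ℝ, E)) 𝓘(ℝ, F) ∞
        (fun y : (G × Cot E Q) × Q => y.1.1⁻¹) :=
      (contMDiff_fst.comp contMDiff_fst).inv
    exact hsmooth.comp (h1.prodMk contMDiff_snd)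
  have hT := ContMDiffAt.mfderiv (x₀ := x₀) (m := ∞) (n := ∞)
    (fun (x : G × Cot E Q) (y : Q) => x.1⁻¹ • y) (fun x => x.1 • x.2.proj)
    hinv.contMDiffAt hbase.contMDiffAt (by simp)
  -- the identity of `T*Q`, with the base points written as `g⁻¹ • g • q`
  let k : G × Cot E Q → Cot E Q := fun x => ⟨x.1⁻¹ • x.1 • x.2.proj, show E →L[ℝ] ℝ from x.2.2⟩
  have hk : k = fun x => x.2 := by
    funext x
    exact cot_mk_eq (inv_smul_smul x.1 x.2.proj) _ _ rfl
  have hks : ContMDiffAt (𝓘(ℝ, F).prod (cotModel E)) (cotModel E) ∞ k x₀ := by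
    rw [hk]; exact contMDiff_snd.contMDiffAt
  have hk2 := (contMDiffAt_cot_iff.1 hks).2
  refine contMDiffAt_cot_iff.2 ⟨hbase.contMDiffAt, ?_⟩
  refine (hk2.clm_comp hT).congr_of_eventuallyEq ?_
  have hsrc : ∀ᶠ x in 𝓝 x₀, (k x).proj ∈ (extChartAt 𝓘(ℝ, E) (k x₀).proj).source :=
    (contMDiff_cot_proj.contMDiffAt.comp x₀ hks).continuousAt.preimage_mem_nhds
      (extChartAt_source_mem_nhds (I := 𝓘(ℝ, E)) _)
  filter_upwards [hsrc] with x hx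
  refine ContinuousLinearMap.ext fun v => ?_
  let u : TangentSpace 𝓘(ℝ, E) (k x).proj := modelTangentAct (E := E) x.1⁻¹ (x.1 • x.2.proj)
    (ofCoordAt 𝓘(ℝ, E) (x₀.1 • x₀.2.proj) (x.1 • x.2.proj) v)
  have hu := ofCoordAt_coordAt (I := 𝓘(ℝ, E)) hx u
  exact congrArg (fun u : TangentSpace 𝓘(ℝ, E) (k x).proj => (k x).2 u) hu.symm

/-- The lifted action is proper because it covers the proper action on `Q`: limits of group elements
along convergent ultrafilters are found in the base. -/
theorem properSMul_lift [T2Space Q]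
    (hsmooth : ContMDiff (𝓘(ℝ, F).prod 𝓘(ℝ, E)) 𝓘(ℝ, E) ∞ (fun x : G × Q => x.1 • x.2))
    (hproper : ProperSMul G Q) :
    letI := liftAction hsmooth
    ProperSMul G (Cot E Q) := by
  let := liftAction hsmooth
  rw [properSMul_iff_continuousSMul_ultrafilter_tendsto_t2]
  refine ⟨⟨(contMDiff_lift hsmooth).continuous⟩, fun 𝒰 p₁ p₂ h => ?_⟩
  rw [properSMul_iff_continuousSMul_ultrafilter_tendsto_t2] at hproper
  have hc : Continuous (fun p : Cot E Q => p.proj) := contMDiff_cot_proj.continuous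
  have h1 : Filter.Tendsto (fun x : G × Q => (x.1 • x.2, x.2))
      (𝒰.map (Prod.map id (fun p : Cot E Q => p.proj))) (𝓝 (p₁.proj, p₂.proj)) := by
    have h2 := ((hc.prodMap hc).tendsto (p₁, p₂)).comp h
    exact Filter.tendsto_map'_iff.2 h2
  obtain ⟨g, hg⟩ := hproper.2 _ _ _ h1
  exact ⟨g, Filter.tendsto_map'_iff.1 hg⟩

omit [IsManifold 𝓘(ℝ, E) ∞ Q] [TopologicalSpace G] in
theorem lift_free (hfree : ∀ (g : G) (q : Q), g • q = q → g = 1) (g : G) (p : Cot E Q)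
    (h : lift g p = p) : g = 1 :=
  hfree g p.proj (congrArg TotalSpace.proj h)

end Lift

/-! ### The momentum map -/

section Momentum

variable {E : Type*} [NormedAddCommGroup E] [NormedSpace ℝ E]
variable {Q : Type*} [TopologicalSpace Q] [ChartedSpace E Q] [IsManifold 𝓘(ℝ, E) ∞ Q]

/-- Smooth covectors evaluated on smooth vectors give smooth functions. -/
theorem contMDiffAt_covector_apply {EM : Type*} [NormedAddCommGroup EM] [NormedSpace ℝ EM]
    {HM : Type*} [TopologicalSpace HM] {IM : ModelWithCorners ℝ EM HM}
    {M : Type*} [TopologicalSpace M] [ChartedSpace HM M] {f : M → Cot E Q} {x₀ : M}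
    {Y : ∀ x, TangentSpace 𝓘(ℝ, E) (f x).proj} (hf : ContMDiffAt IM (cotModel E) ∞ f x₀)
    (hY : ContMDiffAt IM 𝓘(ℝ, E) ∞
      (fun x => coordAt 𝓘(ℝ, E) (f x₀).proj (f x).proj (Y x)) x₀) :
    ContMDiffAt IM 𝓘(ℝ, ℝ) ∞ (fun x => (f x).2 (Y x)) x₀ := by
  obtain ⟨h1, h2⟩ := contMDiffAt_cot_iff.1 hf
  refine (h2.clm_apply hY).congr_of_eventuallyEq ?_
  filter_upwards [h1.continuousAt.preimage_mem_nhds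
    (extChartAt_source_mem_nhds (I := 𝓘(ℝ, E)) _)] with x hx
  exact (congrArg (fun u : TangentSpace 𝓘(ℝ, E) (f x).proj => (f x).2 u)
    (ofCoordAt_coordAt (I := 𝓘(ℝ, E)) hx (Y x))).symm

variable {F : Type*} [NormedAddCommGroup F] [NormedSpace ℝ F]
variable {G : Type*} [TopologicalSpace G] [ChartedSpace F G] [Group G] [LieGroup 𝓘(ℝ, F) ∞ G]
  [MulAction G Q]

theorem contMDiff_generatorQ
    (hsmooth : ContMDiff (𝓘(ℝ, F).prod 𝓘(ℝ, E)) 𝓘(ℝ, E) ∞ (fun x : G × Q => x.1 • x.2))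
    (ξ : GroupLieAlgebra 𝓘(ℝ, F) G) :
    ContMDiff 𝓘(ℝ, E) 𝓘(ℝ, E).tangent ∞
      (fun q => (⟨q, generatorQ ξ q⟩ : TangentBundle 𝓘(ℝ, E) Q)) :=
  contMDiff_infinitesimalAction hsmooth ξ

theorem contMDiff_generator
    (hsmooth : ContMDiff (𝓘(ℝ, F).prod 𝓘(ℝ, E)) 𝓘(ℝ, E) ∞ (fun x : G × Q => x.1 • x.2))
    (ξ : GroupLieAlgebra 𝓘(ℝ, F) G) :
    ContMDiff (cotModel E) (cotModel E).tangent ∞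
      (fun p => (⟨p, generator ξ p⟩ : TangentBundle (cotModel E) (Cot E Q))) :=
  letI := liftAction hsmooth
  contMDiff_infinitesimalAction (I := cotModel E) (P := Cot E Q) (contMDiff_lift hsmooth) ξ

theorem contMDiff_momentum
    (hsmooth : ContMDiff (𝓘(ℝ, F).prod 𝓘(ℝ, E)) 𝓘(ℝ, E) ∞ (fun x : G × Q => x.1 • x.2))
    (ξ : GroupLieAlgebra 𝓘(ℝ, F) G) :
    ContMDiff (cotModel E) 𝓘(ℝ, ℝ) ∞ (momentum (E := E) (Q := Q) ξ) := by
  intro p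
  have h1 := contMDiffAt_vectorField_iff.1 (contMDiff_generatorQ hsmooth ξ p.proj)
  exact contMDiffAt_covector_apply (f := fun p : Cot E Q => p) contMDiffAt_id
    (ContMDiffAt.comp p h1 contMDiff_cot_proj.contMDiffAt)

/-- A curve of covectors that is carried to a fixed covector by the derivative of a family of maps
`m (u, ·)` at `y₀`. -/
theorem hasFDerivAt_covector_family {m : F × E → E} {c : F → E →L[ℝ] ℝ} {P : E →L[ℝ] ℝ}
    {C : F →L[ℝ] E →L[ℝ] ℝ} {z₀ : F × E} (hm : ContDiffAt ℝ ∞ m z₀) (hc : HasFDerivAt c C z₀.1)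
    (hc0 : c z₀.1 = P) (hid : ∀ a, fderiv ℝ m z₀ (0, a) = a)
    (h : ∀ᶠ u in 𝓝 z₀.1, ∀ a, c u (fderiv ℝ m (u, z₀.2) (0, a)) = P a) (ξ : F) (a : E) :
    C ξ a = - P (fderiv ℝ (fderiv ℝ m) z₀ (ξ, 0) (0, a)) := by
  have h2 : HasFDerivAt (fderiv ℝ m) (fderiv ℝ (fderiv ℝ m) z₀) z₀ :=
    ((hm.fderiv_right (m := ∞) (by simp)).differentiableAt (by simp)).hasFDerivAt
  have h3 := HasFDerivAt.comp (g := fderiv ℝ m) (f := fun u : F => (u, z₀.2)) z₀.1 h2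
    (hasFDerivAt_prodMk_left (𝕜 := ℝ) z₀.1 z₀.2)
  have h4 := h3.clm_apply (hasFDerivAt_const ((0 : F), a) z₀.1)
  have h5 := hc.clm_apply h4
  have h6 : HasFDerivAt (fun _ : F => P a) (0 : F →L[ℝ] ℝ) z₀.1 := hasFDerivAt_const _ _
  have h7 := h6.congr_of_eventuallyEq (h.mono fun u hu => hu a)
  have h8 := DFunLike.congr_fun (h5.unique h7) ξ
  have hid' := hid a
  simp [hc0] at h8
  rw [hid'] at h8
  linarith

/-- The derivative, at `(y₀, P)`, of the function `(y, P) ↦ P (∂_ξ m (u₀, y))` linear in `P`. -/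
theorem hasFDerivAt_fiberLinear_family {m : F × E → E} {z₀ : F × E} (hm : ContDiffAt ℝ ∞ m z₀)
    (P : E →L[ℝ] ℝ) (ξ : F) :
    HasFDerivAt (fun z : E × (E →L[ℝ] ℝ) => z.2 (fderiv ℝ m (z₀.1, z.1) (ξ, 0)))
      ((ContinuousLinearMap.snd ℝ E (E →L[ℝ] ℝ)).flip (fderiv ℝ m z₀ (ξ, 0)) +
        P.comp ((((fderiv ℝ (fderiv ℝ m) z₀).comp (ContinuousLinearMap.inr ℝ F E)).flip (ξ, 0)).comp
          (ContinuousLinearMap.fst ℝ E (E →L[ℝ] ℝ)))) (z₀.2, P) := by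
  have h2 : HasFDerivAt (fderiv ℝ m) (fderiv ℝ (fderiv ℝ m) z₀) z₀ :=
    ((hm.fderiv_right (m := ∞) (by simp)).differentiableAt (by simp)).hasFDerivAt
  have h3 := HasFDerivAt.comp (g := fderiv ℝ m) (f := fun y : E => (z₀.1, y)) z₀.2 h2
    (hasFDerivAt_prodMk_right (𝕜 := ℝ) z₀.1 z₀.2)
  have h4 : HasFDerivAt (fun y : E => fderiv ℝ m (z₀.1, y) (ξ, 0))
      (((fderiv ℝ (fderiv ℝ m) z₀).comp (ContinuousLinearMap.inr ℝ F E)).flip (ξ, 0)) z₀.2 := by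
    refine (h3.clm_apply (hasFDerivAt_const (ξ, (0 : E)) z₀.2)).congr_fderiv ?_
    ext; simp
  have h5 := HasFDerivAt.comp (f := fun z : E × (E →L[ℝ] ℝ) => z.1) (z₀.2, P) h4 hasFDerivAt_fst
  have h7 : HasFDerivAt (fun z : E × (E →L[ℝ] ℝ) => z.2)
      (ContinuousLinearMap.snd ℝ E (E →L[ℝ] ℝ)) (z₀.2, P) := hasFDerivAt_snd
  refine (h7.clm_apply h5).congr_fderiv ?_
  rw [add_comm]
  rfl

set_option maxHeartbeats 1000000 in
/-- The momentum map equation `d𝐉^ξ = i_{ξ_{T*Q}} ω`. In canonical coordinates the derivative of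
the covector part of the lifted action and that of `𝐉^ξ` along the base are mixed second
derivatives of the action, taken in opposite orders. -/
theorem diff_momentum
    (hsmooth : ContMDiff (𝓘(ℝ, F).prod 𝓘(ℝ, E)) 𝓘(ℝ, E) ∞ (fun x : G × Q => x.1 • x.2))
    (ξ : GroupLieAlgebra 𝓘(ℝ, F) G) (p : Cot E Q) :
    diff (momentum ξ) p = omegaCan p (generator ξ p) := by
  set q := p.proj with hq
  set φ := extChartAt 𝓘(ℝ, E) q with hφ
  set χ := extChartAt 𝓘(ℝ, F) (1 : G) with hχ
  set e := extChartAt (cotModel E) p with he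
  have hχ1 : (1 : G) ∈ χ.source := mem_extChartAt_source 1
  have hqφ : q ∈ φ.source := mem_extChartAt_source q
  have hpe : p ∈ e.source := mem_extChartAt_source p
  -- the action in charts
  let m : F × E → E := fun z => φ (χ.symm z.1 • φ.symm z.2)
  let P₀ : E →L[ℝ] ℝ := p.2
  let z₀ : F × E := (χ 1, φ q)
  have hep : e p = (φ q, P₀) := by
    rw [he, extChartAt_cot]
    refine Prod.ext rfl (ContinuousLinearMap.ext fun v => ?_)
    exact congrArg p.2 (ofCoordAt_self (I := 𝓘(ℝ, E)) q v)
  have hm : ContDiffAt ℝ ∞ m z₀ := by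
    rw [← contMDiffAt_iff_contDiffAt]
    have h1 : ContMDiffAt 𝓘(ℝ, F) 𝓘(ℝ, F) ∞ χ.symm (χ 1) :=
      (contMDiffOn_extChartAt_symm (1 : G)).contMDiffAt
        ((isOpen_extChartAt_target (1 : G)).mem_nhds (χ.map_source hχ1))
    have h2 : ContMDiffAt 𝓘(ℝ, E) 𝓘(ℝ, E) ∞ φ.symm (φ q) :=
      (contMDiffOn_extChartAt_symm q).contMDiffAt
        ((isOpen_extChartAt_target q).mem_nhds (φ.map_source hqφ))
    have h3 : ContMDiffAt 𝓘(ℝ, F × E) 𝓘(ℝ, F) ∞ (fun z : F × E => χ.symm z.1) z₀ :=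
      ContMDiffAt.comp (g := χ.symm) (f := Prod.fst) z₀ h1 contDiff_fst.contDiffAt.contMDiffAt
    have h4 : ContMDiffAt 𝓘(ℝ, F × E) 𝓘(ℝ, E) ∞ (fun z : F × E => φ.symm z.2) z₀ :=
      ContMDiffAt.comp (g := φ.symm) (f := Prod.snd) z₀ h2 contDiff_snd.contDiffAt.contMDiffAt
    have h5 : ContMDiffAt 𝓘(ℝ, F × E) 𝓘(ℝ, E) ∞ (fun z : F × E => χ.symm z.1 • φ.symm z.2) z₀ :=
      ContMDiffAt.comp z₀ hsmooth.contMDiffAt (h3.prodMk h4)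
    have h6 : ContMDiffAt 𝓘(ℝ, E) 𝓘(ℝ, E) ∞ φ (χ.symm z₀.1 • φ.symm z₀.2) := by
      have : χ.symm z₀.1 • φ.symm z₀.2 = q := by
        simp only [z₀]; rw [χ.left_inv hχ1, φ.left_inv hqφ, one_smul]
      rw [this]
      exact contMDiffAt_extChartAt
    exact ContMDiffAt.comp z₀ h6 h5
  have hmd : ∀ᶠ z in 𝓝 z₀, DifferentiableAt ℝ m z := by
    have : ContDiffAt ℝ 1 m z₀ := hm.of_le (by simp)
    exact (this.eventually (by simp)).mono fun z hz => hz.differentiableAt (by simp)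
  have hmu : ∀ᶠ u in 𝓝 (χ 1), DifferentiableAt ℝ m (u, φ q) :=
    (show ContinuousAt (fun u : F => (u, φ q)) (χ 1) by fun_prop).tendsto.eventually hmd
  have hmy : ∀ᶠ y in 𝓝 (φ q), DifferentiableAt ℝ m (χ 1, y) :=
    (show ContinuousAt (fun y : E => (χ 1, y)) (φ q) by fun_prop).tendsto.eventually hmd
  -- the lifted orbit map in coordinates
  let c : F → E × (E →L[ℝ] ℝ) := fun u => e (lift (χ.symm u) p)
  let Γ : F →L[ℝ] E × (E →L[ℝ] ℝ) := generatorMap (G := G) p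
  have hc : HasFDerivAt c Γ (χ 1) := by
    have hor : HasMFDerivAt 𝓘(ℝ, F) (cotModel E) (fun g : G => lift g p) 1
        (generatorMap (G := G) p) := by
      let := liftAction hsmooth
      exact hasMFDerivAt_orbitMap (I := cotModel E) (P := Cot E Q) (contMDiff_lift hsmooth) p
    have h5 := hasFDerivAt_coord (x₀ := (1 : G)) (y₀ := p) hor.mdifferentiableAt hχ1
      (by rw [lift_one]; exact hpe)
    have h6 : (coordAt (cotModel E) p (lift (1 : G) p)).comp
        ((mfderiv 𝓘(ℝ, F) (cotModel E) (fun g : G => lift g p) 1).comp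
          (ofCoordAt 𝓘(ℝ, F) (1 : G) 1)) = Γ := by
      refine ContinuousLinearMap.ext fun u => ?_
      show coordAt (cotModel E) p (lift (1 : G) p) (mfderiv 𝓘(ℝ, F) (cotModel E)
        (fun g : G => lift g p) 1 (ofCoordAt 𝓘(ℝ, F) (1 : G) 1 u)) = Γ u
      rw [ofCoordAt_self]
      have h7 : ∀ x : Cot E Q, x = p → ∀ v : TCot x,
          (coordAt (cotModel E) p x v : E × (E →L[ℝ] ℝ)) = v := by
        rintro x rfl v; exact coordAt_self x v
      exact h7 _ (lift_one p) _
    rw [h6] at h5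
    exact h5
  have hc0 : c (χ 1) = (φ q, P₀) := by
    simp only [c]; rw [χ.left_inv hχ1, lift_one, hep]
  have hc1 : ∀ u, (c u).1 = m (u, φ q) := by
    intro u
    simp only [c, m]
    rw [he, extChartAt_cot, φ.left_inv hqφ]
    rfl
  -- partial derivatives of `m`
  have hpart2 : ∀ u y, DifferentiableAt ℝ m (u, y) → ∀ a, fderiv ℝ m (u, y) (0, a) =
      fderiv ℝ (fun y => m (u, y)) y a := by
    intro u y hd a
    have h := HasFDerivAt.comp (g := m) (f := fun y : E => (u, y)) y hd.hasFDerivAt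
      (hasFDerivAt_prodMk_right (𝕜 := ℝ) u y)
    exact (DFunLike.congr_fun h.fderiv a).symm
  have hpart1 : ∀ u y, DifferentiableAt ℝ m (u, y) → ∀ ξ, fderiv ℝ m (u, y) (ξ, 0) =
      fderiv ℝ (fun u => m (u, y)) u ξ := by
    intro u y hd a
    have h := HasFDerivAt.comp (g := m) (f := fun u : F => (u, y)) u hd.hasFDerivAt
      (hasFDerivAt_prodMk_left (𝕜 := ℝ) u y)
    exact (DFunLike.congr_fun h.fderiv a).symm
  have hid : ∀ a, fderiv ℝ m z₀ (0, a) = a := by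
    intro a
    rw [hpart2 _ _ hmd.self_of_nhds]
    have : (fun y => m (χ 1, y)) =ᶠ[𝓝 (φ q)] id := by
      filter_upwards [(isOpen_extChartAt_target q).mem_nhds (φ.map_source hqφ)] with y hy
      simp only [m]
      rw [χ.left_inv hχ1, one_smul, φ.right_inv hy]
      rfl
    rw [this.fderiv_eq, fderiv_id]
    rfl
  -- the lifted action transports covectors by the inverse transpose of the derivative of `m`
  have hcu : ∀ᶠ u in 𝓝 z₀.1, ∀ a, (c u).2 (fderiv ℝ m (u, z₀.2) (0, a)) = P₀ a := by
    have hsrc : ∀ᶠ u in 𝓝 (χ 1), χ.symm u • q ∈ φ.source := by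
      have h1 : ContinuousAt χ.symm (χ 1) := continuousAt_extChartAt_symm (1 : G)
      have h2 : ContinuousAt (fun u => χ.symm u • q) (χ 1) :=
        (contMDiff_orbitMap (F := F) (G := G) hsmooth q).continuous.continuousAt.comp h1
      refine h2.preimage_mem_nhds ?_
      rw [χ.left_inv hχ1, one_smul]
      exact extChartAt_source_mem_nhds q
    filter_upwards [hmu, hsrc] with u hu hus a
    rw [hpart2 _ _ hu]
    have h1 := coord_covector_comp_fderiv (hasMFDerivAt_act hsmooth (χ.symm u) q).mdifferentiableAt
      hqφ hus (lift (χ.symm u) p).2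
    have h2 := DFunLike.congr_fun h1 a
    have h3 : (c u).2 = (lift (χ.symm u) p).2.comp (ofCoordAt 𝓘(ℝ, E) q (χ.symm u • q)) := by
      simp only [c]; rw [he, extChartAt_cot]; rfl
    rw [h3]
    refine h2.trans ?_
    refine (lift_apply_tangentAct hsmooth (χ.symm u) p (ofCoordAt 𝓘(ℝ, E) q q a)).trans ?_
    exact congrArg p.2 (ofCoordAt_self (I := 𝓘(ℝ, E)) q a)
  have hΓ2 := hasFDerivAt_covector_family hm hc.snd (by rw [hc0]) hid hcu ξ
  have hΓ1 : (Γ ξ).1 = fderiv ℝ m z₀ (ξ, 0) := by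
    refine Eq.trans ?_ (hpart1 _ _ hmd.self_of_nhds ξ).symm
    have h1 := hc.fst
    simp only [hc1] at h1
    exact (DFunLike.congr_fun h1.fderiv ξ).symm
  -- the momentum in coordinates
  have hJ : (momentum ξ ∘ e.symm) =ᶠ[𝓝 (e p)]
      fun z : E × (E →L[ℝ] ℝ) => z.2 (fderiv ℝ m (χ 1, z.1) (ξ, 0)) := by
    have hcont : ContinuousAt (fun z : E × (E →L[ℝ] ℝ) => z.1) (e p) := by fun_prop
    rw [hep] at hcont
    have hmy' := hcont.eventually hmy
    rw [← hep] at hmy'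
    filter_upwards [(isOpen_extChartAt_target p).mem_nhds (e.map_source hpe), hmy'] with z hz hzm
    obtain ⟨x, hx, rfl⟩ : ∃ x ∈ e.source, e x = z := ⟨_, e.map_target hz, e.right_inv hz⟩
    have hxφ : x.proj ∈ φ.source := mem_extChartAt_cot_source.1 hx
    refine Eq.trans ?_ (congrArg (e x).2 (hpart1 _ _ hzm ξ)).symm
    refine (congrArg (momentum ξ) (e.left_inv hx)).trans ?_
    have hor := hasMFDerivAt_orbitMap (F := F) (G := G) hsmooth x.proj
    have h5 := hasFDerivAt_coord (x₀ := (1 : G)) (y₀ := q) hor.mdifferentiableAt hχ1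
      (by rw [one_smul]; exact hxφ)
    have h6 : (fun u => m (u, (e x).1)) = φ ∘ (fun g : G => g • x.proj) ∘ χ.symm := by
      funext u
      simp only [m, Function.comp_apply]
      rw [he, extChartAt_cot, φ.left_inv hxφ]
    rw [h6, h5.fderiv]
    have h8 : (e x).2 = x.2.comp (ofCoordAt 𝓘(ℝ, E) q x.proj) := by rw [he, extChartAt_cot]
    have h9 : (coordAt 𝓘(ℝ, E) q ((1 : G) • x.proj) ((mfderiv 𝓘(ℝ, F) 𝓘(ℝ, E)
        (fun g : G => g • x.proj) 1) (ofCoordAt 𝓘(ℝ, F) (1 : G) 1 ξ))) =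
        coordAt 𝓘(ℝ, E) q x.proj (generatorQ ξ x.proj) := by
      have h10 : ∀ y : Q, y = x.proj → ∀ v : E,
          coordAt 𝓘(ℝ, E) q y v = coordAt 𝓘(ℝ, E) q x.proj v := by
        rintro y rfl v; rfl
      have h11 : mfderiv 𝓘(ℝ, F) 𝓘(ℝ, E) (fun g : G => g • x.proj) 1
          (ofCoordAt 𝓘(ℝ, F) (1 : G) 1 ξ) = generatorQ ξ x.proj :=
        congrArg (mfderiv 𝓘(ℝ, F) 𝓘(ℝ, E) (fun g : G => g • x.proj) 1)
          (ofCoordAt_self (I := 𝓘(ℝ, F)) (1 : G) ξ)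
      exact (congrArg (coordAt 𝓘(ℝ, E) q ((1 : G) • x.proj)) h11).trans
        (h10 _ (one_smul G _) _)
    refine Eq.trans ?_ (congrArg (e x).2 h9).symm
    rw [h8]
    exact (congrArg (fun v : TangentSpace 𝓘(ℝ, E) x.proj => x.2 v)
      (ofCoordAt_coordAt (I := 𝓘(ℝ, E)) hxφ (generatorQ ξ x.proj))).symm
  have hsymm : IsSymmSndFDerivAt ℝ m z₀ := hm.isSymmSndFDerivAt (by simp; exact ENat.LEInfty.out)
  have hJd : HasFDerivAt (momentum ξ ∘ e.symm) ((differential (cotModel E) (momentum ξ) p).comp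
      (ofCoordAt (cotModel E) p p)) (e p) :=
    hasFDerivAt_differential_coord ((contMDiff_momentum hsmooth ξ).mdifferentiable (by simp) p) hpe
  refine ContinuousLinearMap.ext fun (w : E × (E →L[ℝ] ℝ)) => ?_
  have hw : diff (momentum ξ) p w =
      w.2 (fderiv ℝ m z₀ (ξ, 0)) + P₀ (fderiv ℝ (fderiv ℝ m) z₀ (0, w.1) (ξ, 0)) := by
    have h8 := hasFDerivAt_fiberLinear_family hm P₀ ξ
    rw [hep] at hJ hJd
    have h9 := DFunLike.congr_fun (hJd.unique (h8.congr_of_eventuallyEq hJ)) w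
    have h10 : ((differential (cotModel E) (momentum ξ) p).comp (ofCoordAt (cotModel E) p p)) w =
        diff (momentum ξ) p w :=
      congrArg (differential (cotModel E) (momentum ξ) p) (ofCoordAt_self p w)
    exact h10.symm.trans h9
  refine hw.trans (Eq.trans ?_ (omegaCan_apply (p := p) (Γ ξ) w).symm)
  have h11 : (Γ ξ).2 w.1 = - P₀ (fderiv ℝ (fderiv ℝ m) z₀ (ξ, 0) (0, w.1)) := hΓ2 w.1
  rw [hΓ1, h11, hsymm (ξ, 0) (0, w.1)]
  ring

end Momentum

/-! ### Smooth vector fields and one-forms on the cotangent bundle -/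

section General

variable {E : Type*} [NormedAddCommGroup E] [NormedSpace ℝ E]
  {H : Type*} [TopologicalSpace H] {I : ModelWithCorners ℝ E H}
  {P : Type*} [TopologicalSpace P] [ChartedSpace H P] [IsManifold I ∞ P]

theorem contMDiffAt_coord_add {X Y : ∀ p : P, TangentSpace I p} {p₀ : P}
    (hX : ContMDiffAt I 𝓘(ℝ, E) ∞ (fun p => coordAt I p₀ p (X p)) p₀)
    (hY : ContMDiffAt I 𝓘(ℝ, E) ∞ (fun p => coordAt I p₀ p (Y p)) p₀) :
    ContMDiffAt I 𝓘(ℝ, E) ∞ (fun p => coordAt I p₀ p (X p + Y p)) p₀ := by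
  simp only [map_add]
  exact hX.add hY

theorem contMDiffAt_coord_sum_smul {n : ℕ} {f : Fin n → P → ℝ}
    {X : Fin n → ∀ p : P, TangentSpace I p} {p₀ : P}
    (hf : ∀ i, ContMDiffAt I 𝓘(ℝ, ℝ) ∞ (f i) p₀)
    (hX : ∀ i, ContMDiffAt I 𝓘(ℝ, E) ∞ (fun p => coordAt I p₀ p (X i p)) p₀) :
    ContMDiffAt I 𝓘(ℝ, E) ∞ (fun p => coordAt I p₀ p (∑ i, f i p • X i p)) p₀ := by
  simp only [map_sum, map_smul]
  exact ContMDiffAt.sum fun i _ => (hf i).smul (hX i)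

end General

section Forms

variable {E : Type*} [NormedAddCommGroup E] [NormedSpace ℝ E]
variable {Q : Type*} [TopologicalSpace Q] [ChartedSpace E Q] [IsManifold 𝓘(ℝ, E) ∞ Q]

/-- Smoothness at `p₀` of a vector field on `T*Q`, in the preferred chart at `p₀`. -/
def SmoothFieldAt (X : ∀ p : Cot E Q, TCot p) (p₀ : Cot E Q) : Prop :=
  ContMDiffAt (cotModel E) 𝓘(ℝ, E × (E →L[ℝ] ℝ)) ∞ (fun p => coordAt (cotModel E) p₀ p (X p)) p₀

/-- Smoothness at `p₀` of a `1`-form on `T*Q`, in the preferred chart at `p₀`. -/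
def SmoothFormAt (γ : ∀ p : Cot E Q, TCot p →L[ℝ] ℝ) (p₀ : Cot E Q) : Prop :=
  ContMDiffAt (cotModel E) 𝓘(ℝ, (E × (E →L[ℝ] ℝ)) →L[ℝ] ℝ) ∞
    (fun p => (γ p).comp (ofCoordAt (cotModel E) p₀ p)) p₀

theorem SmoothFieldAt.add {X Y : ∀ p : Cot E Q, TCot p} {p₀ : Cot E Q} (hX : SmoothFieldAt X p₀)
    (hY : SmoothFieldAt Y p₀) : SmoothFieldAt (fun p => X p + Y p) p₀ :=
  contMDiffAt_coord_add hX hY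

theorem SmoothFieldAt.sum_smul {n : ℕ} {f : Fin n → Cot E Q → ℝ}
    {X : Fin n → ∀ p : Cot E Q, TCot p} {p₀ : Cot E Q}
    (hf : ∀ i, ContMDiffAt (cotModel E) 𝓘(ℝ, ℝ) ∞ (f i) p₀) (hX : ∀ i, SmoothFieldAt (X i) p₀) :
    SmoothFieldAt (fun p => ∑ i, f i p • X i p) p₀ :=
  contMDiffAt_coord_sum_smul hf hX

theorem SmoothFormAt.sub {β γ : ∀ p : Cot E Q, TCot p →L[ℝ] ℝ} {p₀ : Cot E Q}
    (hβ : SmoothFormAt β p₀) (hγ : SmoothFormAt γ p₀) : SmoothFormAt (fun p => β p - γ p) p₀ :=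
  ContMDiffAt.sub hβ hγ

theorem SmoothFormAt.apply {γ : ∀ p : Cot E Q, TCot p →L[ℝ] ℝ} {X : ∀ p : Cot E Q, TCot p}
    {p₀ : Cot E Q} (hγ : SmoothFormAt γ p₀) (hX : SmoothFieldAt X p₀) :
    ContMDiffAt (cotModel E) 𝓘(ℝ, ℝ) ∞ (fun p => γ p (X p)) p₀ := by
  refine (hγ.clm_apply hX).congr_of_eventuallyEq ?_
  filter_upwards [extChartAt_source_mem_nhds (I := cotModel E) p₀] with p hp
  exact congrArg (γ p) (ofCoordAt_coordAt hp (X p)).symm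

theorem smoothFormAt_diff {f : Cot E Q → ℝ} {p₀ : Cot E Q}
    (hf : ContMDiffAt (cotModel E) 𝓘(ℝ, ℝ) ∞ f p₀) : SmoothFormAt (diff f) p₀ :=
  contMDiffAt_oneForm_iff.1 (contMDiffAt_differential hf)

theorem SmoothFieldAt.omegaCan {X : ∀ p : Cot E Q, TCot p} {p₀ : Cot E Q}
    (hX : SmoothFieldAt X p₀) : SmoothFormAt (fun p => omegaCan p (X p)) p₀ := by
  have h : ContMDiffAt (cotModel E) 𝓘(ℝ, (E × (E →L[ℝ] ℝ)) →L[ℝ] ℝ) ∞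
      (fun p => omega0 E (coordAt (cotModel E) p₀ p (X p))) p₀ :=
    ContMDiffAt.clm_apply contMDiffAt_const hX
  refine h.congr_of_eventuallyEq ?_
  filter_upwards [extChartAt_source_mem_nhds (I := cotModel E) p₀] with p hp
  refine ContinuousLinearMap.ext fun w => ?_
  refine Eq.trans (omega0_coordAt hp (X p) (ofCoordAt (cotModel E) p₀ p w)).symm ?_
  exact congrArg _ (coordAt_ofCoordAt hp w)

variable [FiniteDimensional ℝ E]

/-- The vector `v` with `i_v ω = γ`. -/
def sharpAt (p : Cot E Q) (γ : TCot p →L[ℝ] ℝ) : TCot p := sharp (E := E) γ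

theorem omegaCan_sharpAt (p : Cot E Q) (γ : TCot p →L[ℝ] ℝ) : omegaCan p (sharpAt p γ) = γ :=
  omega0_sharp γ

theorem SmoothFormAt.sharpAt {γ : ∀ p : Cot E Q, TCot p →L[ℝ] ℝ} {p₀ : Cot E Q}
    (hγ : SmoothFormAt γ p₀) : SmoothFieldAt (fun p => sharpAt p (γ p)) p₀ := by
  have h : ContMDiffAt (cotModel E) 𝓘(ℝ, E × (E →L[ℝ] ℝ)) ∞
      (fun p => sharp ((γ p).comp (ofCoordAt (cotModel E) p₀ p))) p₀ :=
    ContMDiffAt.clm_apply (contMDiffAt_const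
      (c := ((flatEquiv E).symm : ((E × (E →L[ℝ] ℝ)) →L[ℝ] ℝ) →L[ℝ] E × (E →L[ℝ] ℝ)))) hγ
  refine h.congr_of_eventuallyEq ?_
  filter_upwards [extChartAt_source_mem_nhds (I := cotModel E) p₀] with p hp
  refine omega0_injective ?_
  rw [omega0_sharp]
  refine ContinuousLinearMap.ext fun w => ?_
  have h1 := omega0_coordAt hp (Nonholonomic.sharpAt p (γ p)) (ofCoordAt (cotModel E) p₀ p w)
  rw [coordAt_ofCoordAt hp] at h1
  rw [h1, omegaCan_sharpAt]
  rfl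

omit [FiniteDimensional ℝ E] in
theorem omegaCan_antisymm (p : Cot E Q) (v w : TCot p) : omegaCan p v w = - omegaCan p w v := by
  refine (omegaCan_apply (p := p) v w).trans ?_
  rw [show omegaCan p w v = _ from omegaCan_apply (p := p) w v]
  ring

end Forms

/-! ### The Legendre transformation and the phase space constraints -/

theorem isInvertible_of_injective {V W : Type*} [NormedAddCommGroup V] [NormedSpace ℝ V]
    [FiniteDimensional ℝ V] [NormedAddCommGroup W] [NormedSpace ℝ W] [FiniteDimensional ℝ W]
    (hd : Module.finrank ℝ V = Module.finrank ℝ W) (f : V →L[ℝ] W) (hf : Function.Injective f) :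
    f.IsInvertible :=
  ⟨(LinearMap.linearEquivOfInjective (f : V →ₗ[ℝ] W) hf hd).toContinuousLinearEquiv, rfl⟩

theorem finrank_clm_dual (V : Type*) [NormedAddCommGroup V] [NormedSpace ℝ V]
    [FiniteDimensional ℝ V] : Module.finrank ℝ V = Module.finrank ℝ (V →L[ℝ] ℝ) := by
  rw [← (LinearMap.toContinuousLinearMap (𝕜 := ℝ) (E := V) (F' := ℝ)).finrank_eq]
  exact (Subspace.dual_finrank_eq).symm

namespace System

variable {E : Type*} [NormedAddCommGroup E] [NormedSpace ℝ E]
variable {Q : Type*} [TopologicalSpace Q] [ChartedSpace E Q] [IsManifold 𝓘(ℝ, E) ∞ Q]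
variable (S : System E Q)

/-- The coefficients of the metric in the preferred chart at `q₀`. -/
def coordMetric (q₀ q : Q) : E →L[ℝ] E →L[ℝ] ℝ :=
  (ContinuousLinearMap.precomp ℝ (ofCoordAt 𝓘(ℝ, E) q₀ q)).comp
    ((S.legendre q).comp (ofCoordAt 𝓘(ℝ, E) q₀ q))

theorem contMDiffAt_coordMetric (q₀ : Q) :
    ContMDiffAt 𝓘(ℝ, E) 𝓘(ℝ, E →L[ℝ] E →L[ℝ] ℝ) ∞ (S.coordMetric q₀) q₀ := by
  have h := S.metric.contMDiff q₀
  rw [contMDiffAt_section] at h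
  refine h.congr_of_eventuallyEq ?_
  filter_upwards [extChartAt_source_mem_nhds (I := 𝓘(ℝ, E)) q₀] with q hq
  ext v w
  have hq' : q ∈ (trivializationAt (E →L[ℝ] ℝ)
      (fun x : Q => TangentSpace 𝓘(ℝ, E) x →L[ℝ] ℝ) q₀).baseSet := by
    simpa using hq
  simp [hom_trivializationAt_apply, ContinuousLinearMap.inCoordinates,
    Trivialization.coe_linearMapAt_of_mem _ hq']
  rfl

theorem legendre_symm (q : Q) (v w : TangentSpace 𝓘(ℝ, E) q) :
    S.legendre q v w = S.legendre q w v := S.metric.symm q v w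

theorem legendre_pos (q : Q) (v : TangentSpace 𝓘(ℝ, E) q) (hv : v ≠ 0) : 0 < S.legendre q v v :=
  S.metric.pos q v hv

theorem mem_constraint {q : Q} {v : TangentSpace 𝓘(ℝ, E) q} :
    v ∈ S.constraint q ↔ ∀ j, S.φ j q v = 0 := by
  simp [constraint]

variable [FiniteDimensional ℝ E]

omit [FiniteDimensional ℝ E] in
theorem legendre_injective (q : Q) : Function.Injective (S.legendre q) := by
  refine (injective_iff_map_eq_zero _).2 fun v hv => ?_
  by_contra hne
  have := S.legendre_pos q v hne
  rw [hv] at this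
  exact lt_irrefl _ this

theorem isInvertible_legendre (q : Q) : (S.legendre q).IsInvertible :=
  isInvertible_of_injective (V := E) (finrank_clm_dual E) (S.legendre q) (S.legendre_injective q)

/-- The inverse Legendre transformation `𝔽L⁻¹` at `q`. -/
def unlegendre (q : Q) (P : TangentSpace 𝓘(ℝ, E) q →L[ℝ] ℝ) : TangentSpace 𝓘(ℝ, E) q :=
  (S.legendre q).inverse P

theorem legendre_unlegendre (q : Q) (P : TangentSpace 𝓘(ℝ, E) q →L[ℝ] ℝ) :
    S.legendre q (S.unlegendre q P) = P :=
  (S.isInvertible_legendre q).self_apply_inverse P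

theorem unlegendre_legendre (q : Q) (v : TangentSpace 𝓘(ℝ, E) q) :
    S.unlegendre q (S.legendre q v) = v :=
  S.legendre_injective q (S.legendre_unlegendre q _)

/-- `𝔽L⁻¹ : T*Q → TQ` is smooth, as the metric has an invertible smooth coefficient matrix in each
chart. -/
theorem contMDiffAt_unlegendre (p₀ : Cot E Q) :
    ContMDiffAt (cotModel E) 𝓘(ℝ, E) ∞
      (fun p : Cot E Q => coordAt 𝓘(ℝ, E) p₀.proj p.proj (S.unlegendre p.proj p.2)) p₀ := by
  have : CompleteSpace E := FiniteDimensional.complete ℝ E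
  have hg : ContMDiffAt (cotModel E) 𝓘(ℝ, E →L[ℝ] E →L[ℝ] ℝ) ∞
      (fun p : Cot E Q => S.coordMetric p₀.proj p.proj) p₀ :=
    ContMDiffAt.comp p₀ (S.contMDiffAt_coordMetric p₀.proj) contMDiff_cot_proj.contMDiffAt
  have hinj : ∀ᶠ p : Cot E Q in 𝓝 p₀, (S.coordMetric p₀.proj p.proj).IsInvertible := by
    filter_upwards [contMDiff_cot_proj.continuous.continuousAt.preimage_mem_nhds
      (extChartAt_source_mem_nhds (I := 𝓘(ℝ, E)) p₀.proj)] with p hp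
    refine isInvertible_of_injective (finrank_clm_dual E) _ fun v w hvw => ?_
    have hτ : Function.Injective (ofCoordAt 𝓘(ℝ, E) p₀.proj p.proj) :=
      Function.LeftInverse.injective (coordAt_ofCoordAt hp)
    refine hτ (S.legendre_injective p.proj (ContinuousLinearMap.ext fun u => ?_))
    have h := DFunLike.congr_fun hvw (coordAt 𝓘(ℝ, E) p₀.proj p.proj u)
    have h1 : ∀ v, S.coordMetric p₀.proj p.proj v (coordAt 𝓘(ℝ, E) p₀.proj p.proj u) =
        S.legendre p.proj (ofCoordAt 𝓘(ℝ, E) p₀.proj p.proj v) u :=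
      fun v => congrArg (S.legendre p.proj _) (ofCoordAt_coordAt hp u)
    rw [h1, h1] at h
    exact h
  have hinv : ContMDiffAt (cotModel E) 𝓘(ℝ, (E →L[ℝ] ℝ) →L[ℝ] E) ∞
      (fun p : Cot E Q => (S.coordMetric p₀.proj p.proj).inverse) p₀ := by
    have h1 : ContDiffAt ℝ ∞ ContinuousLinearMap.inverse (S.coordMetric p₀.proj p₀.proj) :=
      hinj.self_of_nhds.contDiffAt_map_inverse
    exact ContMDiffAt.comp p₀ h1.contMDiffAt hg
  have hP := (contMDiffAt_cot_iff (f := fun p : Cot E Q => p) (x₀ := p₀)).1 contMDiffAt_id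
  refine (hinv.clm_apply hP.2).congr_of_eventuallyEq ?_
  filter_upwards [hinj, contMDiff_cot_proj.continuous.continuousAt.preimage_mem_nhds
    (extChartAt_source_mem_nhds (I := 𝓘(ℝ, E)) p₀.proj)] with p hpi hp
  refine (hpi.inverse_apply_eq.2 ?_).symm
  refine ContinuousLinearMap.ext fun v => ?_
  refine Eq.symm ((congrArg (fun u : TangentSpace 𝓘(ℝ, E) p.proj => S.legendre p.proj u
    (ofCoordAt 𝓘(ℝ, E) p₀.proj p.proj v)) (ofCoordAt_coordAt hp _)).trans ?_)
  exact DFunLike.congr_fun (S.legendre_unlegendre p.proj p.2) _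

omit [FiniteDimensional ℝ E] in
/-- A constraint form, pulled back along `π` as a map `T*Q → T*Q`. -/
theorem contMDiff_covector (j : Fin S.k) :
    ContMDiff (cotModel E) (cotModel E) ∞ (fun p : Cot E Q => (⟨p.proj, S.φ j p.proj⟩ : Cot E Q)) :=
  (S.smooth_φ j).comp contMDiff_cot_proj

theorem contMDiff_phaseConstraint (j : Fin S.k) :
    ContMDiff (cotModel E) 𝓘(ℝ, ℝ) ∞ (S.phaseConstraint j) := fun p =>
  contMDiffAt_covector_apply (f := fun p : Cot E Q => (⟨p.proj, S.φ j p.proj⟩ : Cot E Q))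
    (S.contMDiff_covector j p) (S.contMDiffAt_unlegendre p)

end System

/-! ### The constraint functions and the Gram matrix -/

namespace System

variable {E : Type*} [NormedAddCommGroup E] [NormedSpace ℝ E]
variable {Q : Type*} [TopologicalSpace Q] [ChartedSpace E Q] [IsManifold 𝓘(ℝ, E) ∞ Q]
variable (S : System E Q)

/-- The pullback `π^*φʲ` of a constraint form to `T*Q`. -/
def constraintForm (j : Fin S.k) (p : Cot E Q) : TCot p →L[ℝ] ℝ :=
  (S.φ j p.proj).comp (tangentProj p)

theorem smoothFormAt_constraintForm (j : Fin S.k) (p₀ : Cot E Q) :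
    SmoothFormAt (S.constraintForm j) p₀ := by
  have h := (contMDiffAt_cot_iff.1 (S.contMDiff_covector j p₀)).2
  have h1 : ContMDiffAt (cotModel E) 𝓘(ℝ, (E × (E →L[ℝ] ℝ)) →L[ℝ] ℝ) ∞
      (fun p : Cot E Q => ((S.φ j p.proj).comp (ofCoordAt 𝓘(ℝ, E) p₀.proj p.proj)).comp
        (ContinuousLinearMap.fst ℝ E (E →L[ℝ] ℝ))) p₀ :=
    h.clm_comp (g := fun p : Cot E Q => (S.φ j p.proj).comp (ofCoordAt 𝓘(ℝ, E) p₀.proj p.proj))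
      contMDiffAt_const
  refine h1.congr_of_eventuallyEq ?_
  filter_upwards [extChartAt_source_mem_nhds (I := cotModel E) p₀] with p hp
  refine ContinuousLinearMap.ext fun w => ?_
  refine (congrArg (S.φ j p.proj) (ofCoordAt_coordAt (mem_extChartAt_cot_source.1 hp) _)).symm.trans
    ?_
  exact congrArg (fun v : E => S.φ j p.proj (ofCoordAt 𝓘(ℝ, E) p₀.proj p.proj v))
    (coordAt_tangentProj hp w)

/-- `ℋ` is the common kernel of the forms `dψʲ` and `π^*φʲ`. -/
theorem mem_Hor {p : Cot E Q} {v : TCot p} : v ∈ S.Hor p ↔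
    (∀ j, diff (S.phaseConstraint j) p v = 0) ∧ ∀ j, S.constraintForm j p v = 0 := by
  simp only [Hor, TM, Submodule.mem_inf, Submodule.mem_iInf, LinearMap.mem_ker,
    Submodule.mem_comap, mem_constraint]
  rfl

variable [FiniteDimensional ℝ E]

/-- `ω^♯(π^*φ)` is the vertical vector `-φ`. -/
theorem sharpAt_constraintForm (j : Fin S.k) (p : Cot E Q) :
    sharpAt p (S.constraintForm j p) = ((0 : E), - (show E →L[ℝ] ℝ from S.φ j p.proj)) := by
  refine omega0_injective ?_
  refine (omegaCan_sharpAt p _).trans ?_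
  refine ContinuousLinearMap.ext fun (w : E × (E →L[ℝ] ℝ)) => ?_
  refine Eq.trans (b := (show E →L[ℝ] ℝ from S.φ j p.proj) w.1) ?_ ?_
  · exact congrArg (S.φ j p.proj) (tangentProj_apply p w)
  · have h : ∀ P : E →L[ℝ] ℝ, P w.1 = omega0 E ((0 : E), -P) w := by
      intro P
      rw [omega0_apply]
      simp
    exact h _

/-- The functions `ψʲ` are linear on the fibres of `T*Q`, so that their derivative in fibre
directions is `δ ↦ φʲ(𝔽L⁻¹ δ)`. -/
theorem diff_phaseConstraint_vertical (j : Fin S.k) (p : Cot E Q) (δ : E →L[ℝ] ℝ) :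
    diff (S.phaseConstraint j) p ((0 : E), δ) = S.φ j p.proj (S.unlegendre p.proj δ) := by
  have h1 := hasFDerivAt_differential_coord (I := cotModel E) (f := S.phaseConstraint j)
    ((S.contMDiff_phaseConstraint j).mdifferentiable (by simp) p) (mem_extChartAt_source p)
  let P₀ : E →L[ℝ] ℝ := p.2
  -- the line through `p` with direction `δ` in its fibre, which is a line in the chart
  let c : ℝ → Cot E Q := fun t => ⟨p.proj, show E →L[ℝ] ℝ from P₀ + t • δ⟩
  have hc : ∀ t, c t ∈ (extChartAt (cotModel E) p).source := fun t =>
    mem_extChartAt_cot_source.2 (mem_extChartAt_source p.proj)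
  have hec : ∀ t, extChartAt (cotModel E) p (c t) =
      extChartAt (cotModel E) p p + t • ((0 : E), δ) := by
    intro t
    rw [extChartAt_cot, extChartAt_cot]
    refine Prod.ext ?_ (ContinuousLinearMap.ext fun v => ?_)
    · simp [c]
    · have hv : (ofCoordAt 𝓘(ℝ, E) p.proj p.proj v : E) = v := ofCoordAt_self (I := 𝓘(ℝ, E)) _ v
      show P₀ (ofCoordAt 𝓘(ℝ, E) p.proj p.proj v) + t • δ (ofCoordAt 𝓘(ℝ, E) p.proj p.proj v) =
        P₀ (ofCoordAt 𝓘(ℝ, E) p.proj p.proj v) + t • δ v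
      exact congrArg (fun u => P₀ (ofCoordAt 𝓘(ℝ, E) p.proj p.proj v) + t • δ u) hv
  have hline : HasDerivAt (fun t : ℝ => extChartAt (cotModel E) p p + t • ((0 : E), δ))
      ((0 : E), δ) 0 := by
    simpa using ((hasDerivAt_id (0 : ℝ)).smul_const ((0 : E), δ)).const_add
      (extChartAt (cotModel E) p p)
  have h0 : extChartAt (cotModel E) p p =
      extChartAt (cotModel E) p p + (0 : ℝ) • ((0 : E), δ) := by rw [zero_smul, add_zero]
  rw [h0] at h1
  have h2 := HasFDerivAt.comp_hasDerivAt (0 : ℝ) h1 hline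
  have h3 : (S.phaseConstraint j ∘ (extChartAt (cotModel E) p).symm) ∘
      (fun t : ℝ => extChartAt (cotModel E) p p + t • ((0 : E), δ)) =
      fun t => S.φ j p.proj (S.unlegendre p.proj p.2) +
        t * S.φ j p.proj (S.unlegendre p.proj δ) := by
    funext t
    simp only [Function.comp_apply]
    rw [← hec, (extChartAt (cotModel E) p).left_inv (hc t)]
    have : ∀ P R : TangentSpace 𝓘(ℝ, E) p.proj →L[ℝ] ℝ, S.φ j p.proj (S.unlegendre p.proj (P + t • R))
        = S.φ j p.proj (S.unlegendre p.proj P) + t * S.φ j p.proj (S.unlegendre p.proj R) := by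
      intro P R
      simp [unlegendre]
    exact this p.2 δ
  rw [h3] at h2
  have h4 : HasDerivAt (fun t => S.φ j p.proj (S.unlegendre p.proj p.2) +
        t * S.φ j p.proj (S.unlegendre p.proj δ)) (S.φ j p.proj (S.unlegendre p.proj δ)) 0 := by
    simpa using ((hasDerivAt_id (0 : ℝ)).mul_const _).const_add
      (S.φ j p.proj (S.unlegendre p.proj p.2))
  refine Eq.trans ?_ (h2.unique h4)
  exact (congrArg (differential (cotModel E) (S.phaseConstraint j) p)
    (ofCoordAt_self (I := cotModel E) p ((0 : E), δ))).symm

/-- The Gram matrix `(φⁱ(𝔽L⁻¹ φʲ))` of the constraint forms, as a linear map. -/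
def gram (q : Q) : (Fin S.k → ℝ) →L[ℝ] (Fin S.k → ℝ) :=
  ∑ i, ∑ j, S.φ i q (S.unlegendre q (S.φ j q)) •
    (ContinuousLinearMap.proj (R := ℝ) (φ := fun _ : Fin S.k => ℝ) j).smulRight (Pi.single i 1)

omit [FiniteDimensional ℝ E] in
theorem gram_apply (q : Q) (μ : Fin S.k → ℝ) (i : Fin S.k) :
    S.gram q μ i = ∑ j, μ j * S.φ i q (S.unlegendre q (S.φ j q)) := by
  simp [gram, Finset.sum_apply, Pi.single_apply, mul_comm]

theorem gram_symm (q : Q) (i j : Fin S.k) :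
    S.φ i q (S.unlegendre q (S.φ j q)) = S.φ j q (S.unlegendre q (S.φ i q)) := by
  have h : ∀ i j, S.φ i q (S.unlegendre q (S.φ j q)) =
      S.legendre q (S.unlegendre q (S.φ i q)) (S.unlegendre q (S.φ j q)) := by
    intro i j
    rw [legendre_unlegendre]
  rw [h, h, legendre_symm]

/-- If `μ` is in the kernel of the Gram matrix then `ν = ∑ μⱼ φʲ` satisfies `ν(𝔽L⁻¹ ν) = 0`. -/
theorem gram_injective (q : Q) : Function.Injective (S.gram q) := by
  refine (injective_iff_map_eq_zero _).2 fun μ hμ => ?_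
  let ν : TangentSpace 𝓘(ℝ, E) q →L[ℝ] ℝ := ∑ j, μ j • S.φ j q
  have h1 : ν (S.unlegendre q ν) = 0 := by
    have : ν (S.unlegendre q ν) = ∑ i, μ i * S.gram q μ i := by
      simp only [ν, unlegendre, gram_apply, map_sum, sum_apply, map_smul, smul_apply, smul_eq_mul,
        Finset.mul_sum]
      rw [Finset.sum_comm]
      exact Finset.sum_congr rfl fun i _ => Finset.sum_congr rfl fun j _ => by ring
    rw [this, hμ]
    simp
  have h2 : S.unlegendre q ν = 0 := by
    by_contra hne
    have := S.legendre_pos q _ hne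
    rw [legendre_unlegendre, h1] at this
    exact lt_irrefl _ this
  have h3 : ν = 0 := by
    rw [← S.legendre_unlegendre q ν, h2, map_zero]
  funext j
  exact Fintype.linearIndependent_iff.1 (S.linearIndependent_φ q) μ h3 j

theorem isInvertible_gram (q : Q) : (S.gram q).IsInvertible :=
  isInvertible_of_injective rfl _ (S.gram_injective q)

theorem contMDiff_gram : ContMDiff (cotModel E) 𝓘(ℝ, (Fin S.k → ℝ) →L[ℝ] (Fin S.k → ℝ)) ∞
    (fun p : Cot E Q => S.gram p.proj) := by
  refine contMDiff_finsetSum fun i _ => contMDiff_finsetSum fun j _ => ?_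
  have h : ContMDiff (cotModel E) 𝓘(ℝ, ℝ) ∞
      (fun p : Cot E Q => S.φ i p.proj (S.unlegendre p.proj (S.φ j p.proj))) :=
    (S.contMDiff_phaseConstraint i).comp (S.contMDiff_covector j)
  exact h.smul contMDiff_const

theorem contMDiff_gram_inverse_apply {y : Cot E Q → Fin S.k → ℝ}
    (hy : ∀ i, ContMDiff (cotModel E) 𝓘(ℝ, ℝ) ∞ (fun p => y p i)) (i : Fin S.k) :
    ContMDiff (cotModel E) 𝓘(ℝ, ℝ) ∞ (fun p => (S.gram p.proj).inverse (y p) i) := by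
  have h1 : ContMDiff (cotModel E) 𝓘(ℝ, (Fin S.k → ℝ) →L[ℝ] (Fin S.k → ℝ)) ∞
      (fun p : Cot E Q => (S.gram p.proj).inverse) := fun p =>
    ContMDiffAt.comp p (S.isInvertible_gram p.proj).contDiffAt_map_inverse.contMDiffAt
      (S.contMDiff_gram p)
  have h2 := h1.clm_apply (contMDiff_pi_space.2 hy)
  exact contMDiff_pi_space.1 h2 i

/-- The fields `ω^♯(dψʲ)` and `ω^♯(π^*φʲ)` pair with the forms `dψⁱ` and `π^*φⁱ` through the Gram
matrix. -/
theorem diff_phaseConstraint_sharpAt (i j : Fin S.k) (p : Cot E Q) :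
    diff (S.phaseConstraint i) p (sharpAt p (S.constraintForm j p)) =
      - S.φ i p.proj (S.unlegendre p.proj (S.φ j p.proj)) := by
  refine (congrArg (diff (S.phaseConstraint i) p) (S.sharpAt_constraintForm j p)).trans ?_
  refine (S.diff_phaseConstraint_vertical i p _).trans ?_
  refine Eq.trans (b := S.φ i p.proj (S.unlegendre p.proj (- S.φ j p.proj))) rfl ?_
  simp [unlegendre]

theorem constraintForm_sharpAt (i j : Fin S.k) (p : Cot E Q) :
    S.constraintForm i p (sharpAt p (S.constraintForm j p)) = 0 := by
  refine (congrArg (S.φ i p.proj) (Eq.trans (congrArg (tangentProj p)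
    (S.sharpAt_constraintForm j p)) (tangentProj_apply p _))).trans ?_
  exact map_zero (S.φ i p.proj)

theorem constraintForm_sharpAt_diff (i j : Fin S.k) (p : Cot E Q) :
    S.constraintForm i p (sharpAt p (diff (S.phaseConstraint j) p)) =
      S.φ i p.proj (S.unlegendre p.proj (S.φ j p.proj)) := by
  rw [← omegaCan_sharpAt p (S.constraintForm i p), omegaCan_antisymm, omegaCan_sharpAt,
    diff_phaseConstraint_sharpAt, neg_neg, gram_symm]

end System

/-! ### The projection to the horizontal distribution -/

theorem clm_apply_add_sum_smul {V : Type*} [AddCommGroup V] [Module ℝ V] [TopologicalSpace V]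
    (L : V →L[ℝ] ℝ) (w : V) {n : ℕ} (a : Fin n → ℝ) (X : Fin n → V) :
    L (w + ∑ j, a j • X j) = L w + ∑ j, a j * L (X j) := by
  simp

theorem clm_apply_sub₂ {V : Type*} [AddCommGroup V] [Module ℝ V] [TopologicalSpace V]
    (B : V →L[ℝ] V →L[ℝ] ℝ) (v v' w : V) : B (v - v') w = B v w - B v' w := by
  simp

namespace System

variable {E : Type*} [NormedAddCommGroup E] [NormedSpace ℝ E]
variable {Q : Type*} [TopologicalSpace Q] [ChartedSpace E Q] [IsManifold 𝓘(ℝ, E) ∞ Q]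
variable [FiniteDimensional ℝ E] (S : System E Q)

/-- The component of `w` in `(Tπ)⁻¹(𝒟)`, along the vectors `ω^♯(dψʲ)`. Its coefficients are solved
for with the Gram matrix, which is the pairing of the forms `π^*φⁱ` with these vectors. -/
def projConstraint (p : Cot E Q) (w : TCot p) : TCot p :=
  w + ∑ j, (S.gram p.proj).inverse (fun i => - S.constraintForm i p w) j •
    sharpAt p (diff (S.phaseConstraint j) p)

/-- The projection of `T_p(T*Q)` to `ℋ(p)` along the span of the vectors `ω^♯(dψʲ)` and
`ω^♯(π^*φʲ)`. The span of these vectors is the `ω`-orthogonal complement of `ℋ(p)`. -/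
def projHor (p : Cot E Q) (w : TCot p) : TCot p :=
  S.projConstraint p w + ∑ j, (S.gram p.proj).inverse
    (fun i => diff (S.phaseConstraint i) p (S.projConstraint p w)) j •
    sharpAt p (S.constraintForm j p)

theorem gram_inverse_apply (q : Q) (y : Fin S.k → ℝ) (i : Fin S.k) :
    ∑ j, (S.gram q).inverse y j * S.φ i q (S.unlegendre q (S.φ j q)) = y i := by
  rw [← gram_apply, (S.isInvertible_gram q).self_apply_inverse]

theorem constraintForm_projConstraint (i : Fin S.k) (p : Cot E Q) (w : TCot p) :
    S.constraintForm i p (S.projConstraint p w) = 0 := by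
  rw [projConstraint, clm_apply_add_sum_smul]
  simp only [constraintForm_sharpAt_diff, gram_inverse_apply]
  ring

theorem projHor_mem_Hor (p : Cot E Q) (w : TCot p) : S.projHor p w ∈ S.Hor p := by
  refine S.mem_Hor.2 ⟨fun i => ?_, fun i => ?_⟩
  · rw [projHor, clm_apply_add_sum_smul]
    simp only [diff_phaseConstraint_sharpAt, mul_neg, Finset.sum_neg_distrib,
      gram_inverse_apply]
    ring
  · rw [projHor, clm_apply_add_sum_smul, constraintForm_projConstraint]
    simp only [constraintForm_sharpAt]
    simp

theorem omegaCan_sharpAt_diff_of_mem_Hor {p : Cot E Q} {v : TCot p} (hv : v ∈ S.Hor p)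
    (j : Fin S.k) : omegaCan p v (sharpAt p (diff (S.phaseConstraint j) p)) = 0 := by
  rw [omegaCan_antisymm, omegaCan_sharpAt, (S.mem_Hor.1 hv).1 j, neg_zero]

theorem omegaCan_sharpAt_constraintForm_of_mem_Hor {p : Cot E Q} {v : TCot p} (hv : v ∈ S.Hor p)
    (j : Fin S.k) : omegaCan p v (sharpAt p (S.constraintForm j p)) = 0 := by
  rw [omegaCan_antisymm, omegaCan_sharpAt, (S.mem_Hor.1 hv).2 j, neg_zero]

/-- `w - projHor w` is `ω`-orthogonal to `ℋ`. -/
theorem omegaCan_projHor {p : Cot E Q} {v : TCot p} (hv : v ∈ S.Hor p) (w : TCot p) :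
    omegaCan p v (S.projHor p w) = omegaCan p v w := by
  rw [projHor, clm_apply_add_sum_smul, projConstraint, clm_apply_add_sum_smul]
  simp only [S.omegaCan_sharpAt_diff_of_mem_Hor hv,
    S.omegaCan_sharpAt_constraintForm_of_mem_Hor hv]
  simp

/-- `ω` is nondegenerate on `ℋ`. -/
theorem eq_zero_of_mem_Hor {p : Cot E Q} {v : TCot p} (hv : v ∈ S.Hor p)
    (h : ∀ w ∈ S.Hor p, omegaCan p v w = 0) : v = 0 :=
  eq_zero_of_omega0_eq_zero (E := E) fun w =>
    (S.omegaCan_projHor hv w).symm.trans (h _ (S.projHor_mem_Hor p w))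

/-- The vector field on `T*Q` with values in `ℋ` whose restriction to `M` is the vector field of
the nonholonomic system with Hamiltonian `h`. -/
def hamiltonianField (h : Cot E Q → ℝ) (p : Cot E Q) : TCot p :=
  S.projHor p (sharpAt p (diff h p))

theorem hamiltonianField_mem_Hor (h : Cot E Q → ℝ) (p : Cot E Q) :
    S.hamiltonianField h p ∈ S.Hor p := S.projHor_mem_Hor p _

theorem omegaCan_hamiltonianField (h : Cot E Q → ℝ) {p : Cot E Q} {w : TCot p}
    (hw : w ∈ S.Hor p) : omegaCan p (S.hamiltonianField h p) w = diff h p w := by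
  rw [omegaCan_antisymm, hamiltonianField, S.omegaCan_projHor hw, ← omegaCan_antisymm,
    omegaCan_sharpAt]

theorem eq_hamiltonianField {h : Cot E Q → ℝ} {p : Cot E Q} {v : TCot p} (hv : v ∈ S.Hor p)
    (hvh : ∀ w ∈ S.Hor p, omegaCan p v w = diff h p w) : v = S.hamiltonianField h p := by
  refine sub_eq_zero.1 (S.eq_zero_of_mem_Hor
    (Submodule.sub_mem _ hv (S.hamiltonianField_mem_Hor h p)) fun w hw => ?_)
  rw [clm_apply_sub₂, hvh w hw, S.omegaCan_hamiltonianField h hw, sub_self]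

theorem smoothFieldAt_projConstraint {X : ∀ p : Cot E Q, TCot p} (hX : ∀ p, SmoothFieldAt X p)
    (p₀ : Cot E Q) : SmoothFieldAt (fun p => S.projConstraint p (X p)) p₀ := by
  refine (hX p₀).add (SmoothFieldAt.sum_smul (fun j => ?_)
    fun j => (smoothFormAt_diff (S.contMDiff_phaseConstraint j p₀)).sharpAt)
  exact S.contMDiff_gram_inverse_apply (y := fun p i => - S.constraintForm i p (X p))
    (fun i p => ((S.smoothFormAt_constraintForm i p).apply (hX p)).neg) j p₀

theorem smoothFieldAt_projHor {X : ∀ p : Cot E Q, TCot p} (hX : ∀ p, SmoothFieldAt X p)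
    (p₀ : Cot E Q) : SmoothFieldAt (fun p => S.projHor p (X p)) p₀ := by
  refine (S.smoothFieldAt_projConstraint hX p₀).add (SmoothFieldAt.sum_smul (fun j => ?_)
    fun j => (S.smoothFormAt_constraintForm j p₀).sharpAt)
  exact S.contMDiff_gram_inverse_apply
    (y := fun p i => diff (S.phaseConstraint i) p (S.projConstraint p (X p)))
    (fun i p => (smoothFormAt_diff (S.contMDiff_phaseConstraint i p)).apply
      (S.smoothFieldAt_projConstraint hX p)) j p₀

theorem smoothFieldAt_hamiltonianField {h : Cot E Q → ℝ}
    (hh : ContMDiff (cotModel E) 𝓘(ℝ, ℝ) ∞ h) (p₀ : Cot E Q) :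
    SmoothFieldAt (S.hamiltonianField h) p₀ :=
  S.smoothFieldAt_projHor (fun p => (smoothFormAt_diff (hh p)).sharpAt) p₀

theorem contMDiff_hamiltonianField {h : Cot E Q → ℝ} (hh : ContMDiff (cotModel E) 𝓘(ℝ, ℝ) ∞ h) :
    ContMDiff (cotModel E) (cotModel E).tangent ∞
      (fun p => (⟨p, S.hamiltonianField h p⟩ : TangentBundle (cotModel E) (Cot E Q))) :=
  fun p => contMDiffAt_vectorField_iff.2 (S.smoothFieldAt_hamiltonianField hh p)

end System

/-! ### Invariance of the constraint submanifold -/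

section Invariance

variable {E : Type*} [NormedAddCommGroup E] [NormedSpace ℝ E]
variable {Q : Type*} [TopologicalSpace Q] [ChartedSpace E Q] [IsManifold 𝓘(ℝ, E) ∞ Q]
variable {F : Type*} [NormedAddCommGroup F] [NormedSpace ℝ F]
variable {G : Type*} [TopologicalSpace G] [ChartedSpace F G] [Group G] [LieGroup 𝓘(ℝ, F) ∞ G]
  [MulAction G Q]

omit [IsManifold 𝓘(ℝ, E) ∞ Q] [LieGroup 𝓘(ℝ, F) ∞ G] in
theorem tangentAct_surjective
    (hsmooth : ContMDiff (𝓘(ℝ, F).prod 𝓘(ℝ, E)) 𝓘(ℝ, E) ∞ (fun x : G × Q => x.1 • x.2))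
    (g : G) (q : Q) : Function.Surjective (tangentAct (E := E) g q) := by
  intro w
  have h := modelTangentAct_mul hsmooth g g⁻¹ (g • q)
  rw [mul_inv_cancel, modelTangentAct_one, inv_smul_smul] at h
  exact ⟨modelTangentAct (E := E) g⁻¹ (g • q) w, (DFunLike.congr_fun h w).symm⟩

/-- The differential of a function that is constant on the orbit of `p` annihilates the
generators at `p`. -/
theorem diff_generatorMap_eq_zero
    (hsmooth : ContMDiff (𝓘(ℝ, F).prod 𝓘(ℝ, E)) 𝓘(ℝ, E) ∞ (fun x : G × Q => x.1 • x.2))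
    {f : Cot E Q → ℝ} (hf : ContMDiff (cotModel E) 𝓘(ℝ, ℝ) ∞ f) {p : Cot E Q}
    (hfp : ∀ g : G, f (lift g p) = f p) (η : GroupLieAlgebra 𝓘(ℝ, F) G) :
    diff f p (generatorMap p η) = 0 := by
  let := liftAction hsmooth
  exact differential_infinitesimalAction_eq_zero (I := cotModel E) (P := Cot E Q)
    (contMDiff_lift hsmooth) (hf.mdifferentiable (by simp) p) hfp η

namespace System

variable [FiniteDimensional ℝ E] (S : System E Q)

omit [FiniteDimensional ℝ E] [TopologicalSpace G] in
variable {S} in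
/-- An invariant Lagrangian has an invariant potential, by its values on the zero section, and hence
an invariant metric, by polarization. -/
theorem legendre_tangentAct
    (hlagrangian : ∀ (g : G) (q : Q) (v : TangentSpace 𝓘(ℝ, E) q),
      S.lagrangian (g • q) (tangentAct g q v) = S.lagrangian q v)
    (g : G) (q : Q) (v w : TangentSpace 𝓘(ℝ, E) q) :
    S.legendre (g • q) (tangentAct g q v) (tangentAct g q w) = S.legendre q v w := by
  have hV : S.potential (g • q) = S.potential q := by
    have := hlagrangian g q 0
    simp [lagrangian] at this
    exact this
  have hq : ∀ v, S.legendre (g • q) (tangentAct g q v) (tangentAct g q v) = S.legendre q v v := by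
    intro v
    have := hlagrangian g q v
    simp only [lagrangian, hV] at this
    show S.metric.inner _ _ _ = S.metric.inner _ _ _
    linarith
  have h := hq (v + w)
  simp only [map_add, add_apply, hq] at h
  rw [S.legendre_symm _ (tangentAct g q w), S.legendre_symm _ w v] at h
  linarith

omit [LieGroup 𝓘(ℝ, F) ∞ G] in
/-- The constraint submanifold is invariant under the lifted action. -/
theorem lift_mem_M
    (hsmooth : ContMDiff (𝓘(ℝ, F).prod 𝓘(ℝ, E)) 𝓘(ℝ, E) ∞ (fun x : G × Q => x.1 • x.2))
    (hconstraint : ∀ (g : G) (q : Q), ∀ v ∈ S.constraint q,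
      tangentAct g q v ∈ S.constraint (g • q))
    (hlagrangian : ∀ (g : G) (q : Q) (v : TangentSpace 𝓘(ℝ, E) q),
      S.lagrangian (g • q) (tangentAct g q v) = S.lagrangian q v)
    (g : G) {p : Cot E Q} (hp : p ∈ S.M) : lift g p ∈ S.M := by
  have hv : S.unlegendre p.proj p.2 ∈ S.constraint p.proj := S.mem_constraint.2 hp
  have h1 : (lift g p).2 = S.legendre (g • p.proj)
      (tangentAct g p.proj (S.unlegendre p.proj p.2)) := by
    refine ContinuousLinearMap.ext fun w => ?_
    obtain ⟨u, rfl⟩ := tangentAct_surjective hsmooth g p.proj w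
    refine (lift_apply_tangentAct hsmooth g p u).trans ?_
    refine Eq.trans ?_ (legendre_tangentAct hlagrangian g p.proj _ u).symm
    rw [legendre_unlegendre]
  intro j
  have h2 : S.unlegendre (g • p.proj) (lift g p).2 =
      tangentAct g p.proj (S.unlegendre p.proj p.2) :=
    (congrArg (S.unlegendre (g • p.proj)) h1).trans (S.unlegendre_legendre _ _)
  exact (congrArg (S.φ j (g • p.proj)) h2).trans
    (S.mem_constraint.1 (hconstraint g p.proj _ hv) j)

theorem generatorMap_mem_TM
    (hsmooth : ContMDiff (𝓘(ℝ, F).prod 𝓘(ℝ, E)) 𝓘(ℝ, E) ∞ (fun x : G × Q => x.1 • x.2))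
    (hconstraint : ∀ (g : G) (q : Q), ∀ v ∈ S.constraint q,
      tangentAct g q v ∈ S.constraint (g • q))
    (hlagrangian : ∀ (g : G) (q : Q) (v : TangentSpace 𝓘(ℝ, E) q),
      S.lagrangian (g • q) (tangentAct g q v) = S.lagrangian q v)
    {p : Cot E Q} (hp : p ∈ S.M) (η : GroupLieAlgebra 𝓘(ℝ, F) G) :
    generatorMap p η ∈ S.TM p := by
  refine (Submodule.mem_iInf _).2 fun j => ?_
  exact diff_generatorMap_eq_zero hsmooth (S.contMDiff_phaseConstraint j)
    (fun g => (S.lift_mem_M hsmooth hconstraint hlagrangian g hp j).trans (hp j).symm) η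

end System

end Invariance

/-! ### Solution curves and reaction forces -/

theorem clm_eq_toSpanSingleton {V : Type*} [AddCommGroup V] [Module ℝ V] [TopologicalSpace V]
    [ContinuousSMul ℝ V] (L : ℝ →L[ℝ] V) : L = ContinuousLinearMap.toSpanSingleton ℝ (L 1) :=
  ContinuousLinearMap.ext_ring (by simp)

namespace System

variable {E : Type*} [NormedAddCommGroup E] [NormedSpace ℝ E] [FiniteDimensional ℝ E]
variable {Q : Type*} [TopologicalSpace Q] [ChartedSpace E Q] [IsManifold 𝓘(ℝ, E) ∞ Q]
variable {F : Type*} [NormedAddCommGroup F] [NormedSpace ℝ F]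
variable {G : Type*} [TopologicalSpace G] [ChartedSpace F G] [Group G] [LieGroup 𝓘(ℝ, F) ∞ G]
  [MulAction G Q]
variable (S : System E Q)

/-- The velocity of a solution curve is the value of the Hamiltonian vector field. -/
theorem IsSolution.hasMFDerivAt {S : System E Q} {h : Cot E Q → ℝ} {a b : ℝ} {c : ℝ → Cot E Q}
    (hc : S.IsSolution h a b c) {t : ℝ} (ht : t ∈ Ioo a b) :
    HasMFDerivAt 𝓘(ℝ, ℝ) (cotModel E) c t
      (ContinuousLinearMap.toSpanSingleton ℝ (S.hamiltonianField h (c t))) := by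
  have h1 : HasMFDerivAt 𝓘(ℝ, ℝ) (cotModel E) c t (mfderiv 𝓘(ℝ, ℝ) (cotModel E) c t) :=
    ((hc.1.contMDiffAt (isOpen_Ioo.mem_nhds ht)).mdifferentiableAt (by simp)).hasMFDerivAt
  obtain ⟨-, h2, h3⟩ := hc.2 t ht
  have h4 := S.eq_hamiltonianField (h := h) h2 fun w hw => by
    have h5 := h3 ⟨w, hw.1⟩ hw
    have h6 : diff h (c t) w - omegaCan (c t) (mfderiv 𝓘(ℝ, ℝ) (cotModel E) c t (1 : ℝ)) w = 0 := h5
    linarith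
  rw [← h4]
  have h7 : mfderiv 𝓘(ℝ, ℝ) (cotModel E) c t =
      ContinuousLinearMap.toSpanSingleton ℝ
        (mfderiv 𝓘(ℝ, ℝ) (cotModel E) c t (1 : ℝ) : TCot (c t)) :=
    clm_eq_toSpanSingleton (V := TCot (c t)) (mfderiv 𝓘(ℝ, ℝ) (cotModel E) c t)
  exact h7 ▸ h1

/-- Through every point of `M` there is a solution curve. It is an integral curve of a vector field
that annihilates the functions defining `M`. -/
theorem exists_isSolution {h : Cot E Q → ℝ}
    (hh : ContMDiff (cotModel E) 𝓘(ℝ, ℝ) ∞ h) {p : Cot E Q} (hp : p ∈ S.M) :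
    ∃ ε > 0, ∃ c : ℝ → Cot E Q, c 0 = p ∧ S.IsSolution h (-ε) ε c := by
  have hX := S.contMDiff_hamiltonianField hh
  have : CompleteSpace (E × (E →L[ℝ] ℝ)) := FiniteDimensional.complete ℝ _
  obtain ⟨c, hc0, hc⟩ := exists_isMIntegralCurveAt_of_contMDiffAt_boundaryless (t₀ := (0 : ℝ))
    ((hX p).of_le (by simp))
  obtain ⟨ε, hε, hc⟩ := isMIntegralCurveAt_iff'.1 hc
  rw [Real.ball_eq_Ioo, zero_sub, zero_add] at hc
  have hc' : ∀ t ∈ Ioo (-ε) ε, IsMIntegralCurveAt c (S.hamiltonianField h) t :=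
    (isMIntegralCurveOn_iff_isMIntegralCurveAt isOpen_Ioo).1 hc
  have hcd : ∀ t ∈ Ioo (-ε) ε, HasMFDerivAt 𝓘(ℝ, ℝ) (cotModel E) c t
      (ContinuousLinearMap.toSpanSingleton ℝ (S.hamiltonianField h (c t))) :=
    fun t ht => isMIntegralCurveAt_hasMFDerivAt (hc' t ht)
  have hcM : ∀ t ∈ Ioo (-ε) ε, c t ∈ S.M := by
    intro t ht j
    have hd : ∀ t ∈ Ioo (-ε) ε, HasDerivAt (S.phaseConstraint j ∘ c) 0 t := by
      intro t ht
      have h1 := hasDerivAt_comp_curve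
        ((S.contMDiff_phaseConstraint j).mdifferentiable (by simp) (c t)) (hcd t ht)
      have h2 := (S.mem_Hor.1 (S.hamiltonianField_mem_Hor h (c t))).1 j
      exact h2 ▸ h1
    have h0 : (0 : ℝ) ∈ Ioo (-ε) ε := ⟨by linarith, hε⟩
    have h3 : (S.phaseConstraint j ∘ c) t = (S.phaseConstraint j ∘ c) 0 :=
      isOpen_Ioo.is_const_of_deriv_eq_zero isPreconnected_Ioo
        (fun t ht => (hd t ht).differentiableAt.differentiableWithinAt)
        (fun t ht => (hd t ht).deriv) ht h0
    refine h3.trans ?_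
    rw [Function.comp_apply, hc0]
    exact hp j
  refine ⟨ε, hε, c, hc0, fun t ht => (contMDiffAt_integralCurve hX (hc' t ht)).contMDiffWithinAt,
    fun t ht => ⟨hcM t ht, ?_⟩⟩
  have hv : mfderiv 𝓘(ℝ, ℝ) (cotModel E) c t (1 : ℝ) = S.hamiltonianField h (c t) := by
    rw [(hcd t ht).mfderiv]
    exact one_smul ℝ (S.hamiltonianField h (c t))
  rw [hv]
  refine ⟨S.hamiltonianField_mem_Hor h (c t), fun w hw => ?_⟩
  exact sub_eq_zero.2 (S.omegaCan_hamiltonianField h hw).symm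

theorem isSectionOn_hamiltonianField
    (hsmooth : ContMDiff (𝓘(ℝ, F).prod 𝓘(ℝ, E)) 𝓘(ℝ, E) ∞ (fun x : G × Q => x.1 • x.2))
    {h : Cot E Q → ℝ} (hh : ContMDiff (cotModel E) 𝓘(ℝ, ℝ) ∞ h)
    (hG : ∀ (g : G), ∀ p ∈ S.M, h (lift g p) = h p) :
    S.IsSectionOn univ (S.horAnn F G) (S.hamiltonianField h) := by
  refine ⟨isOpen_univ, (S.contMDiff_hamiltonianField hh).contMDiffOn, fun p hp => ?_⟩
  have h1 := S.hamiltonianField_mem_Hor h p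
  refine ⟨h1.1, h1, fun w hw => ?_⟩
  obtain ⟨⟨η, rfl⟩, hw⟩ := hw
  rw [S.omegaCan_hamiltonianField h hw]
  exact diff_generatorMap_eq_zero hsmooth hh (fun g => hG g p hp.2) η

/-- The reaction force `dh - i_X ω_M` of an invariant Hamiltonian is a section of `ℛ`. -/
theorem isCosectionOn_reaction
    (hsmooth : ContMDiff (𝓘(ℝ, F).prod 𝓘(ℝ, E)) 𝓘(ℝ, E) ∞ (fun x : G × Q => x.1 • x.2))
    {h : Cot E Q → ℝ} (hh : ContMDiff (cotModel E) 𝓘(ℝ, ℝ) ∞ h)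
    (hG : ∀ (g : G), ∀ p ∈ S.M, h (lift g p) = h p) :
    S.IsCosectionOn univ (S.reaction F G)
      (fun p => diff h p - omegaCan p (S.hamiltonianField h p)) := by
  have hβ : ContMDiffOn (cotModel E) ((cotModel E).prod 𝓘(ℝ, (E × (E →L[ℝ] ℝ)) →L[ℝ] ℝ)) ∞
    (fun p => TotalSpace.mk' (E := fun p : Cot E Q => TCot p →L[ℝ] ℝ)
      ((E × (E →L[ℝ] ℝ)) →L[ℝ] ℝ) p (diff h p - omegaCan p (S.hamiltonianField h p))) univ :=
    fun p _ => (contMDiffAt_oneForm_iff.2 ((smoothFormAt_diff (hh p)).sub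
      (S.smoothFieldAt_hamiltonianField hh p).omegaCan)).contMDiffWithinAt
  have hd : ContMDiffOn (cotModel E) ((cotModel E).prod 𝓘(ℝ, (E × (E →L[ℝ] ℝ)) →L[ℝ] ℝ)) ∞
    (fun p => TotalSpace.mk' (E := fun p : Cot E Q => TCot p →L[ℝ] ℝ)
      ((E × (E →L[ℝ] ℝ)) →L[ℝ] ℝ) p (diff h p)) univ :=
    fun p _ => (contMDiffAt_oneForm_iff.2 (smoothFormAt_diff (hh p))).contMDiffWithinAt
  refine ⟨isOpen_univ, hβ, fun p hp => ⟨univ, _, S.hamiltonianField h, mem_univ p,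
    ⟨isOpen_univ, hβ, fun q _ v hv => ?_⟩, S.isSectionOn_hamiltonianField hsmooth hh hG,
    ⟨isOpen_univ, ?_, fun q hq v hv => ?_⟩, rfl⟩⟩
  · exact sub_eq_zero.2 (S.omegaCan_hamiltonianField h hv).symm
  · simp only [sub_add_cancel]
    exact hd
  · obtain ⟨η, hη⟩ := hv
    have h1 := diff_generatorMap_eq_zero hsmooth hh (fun g => hG g q hq.2) η
    simp only [sub_add_cancel]
    exact (congrArg (diff h q) hη).symm.trans h1

end System

end Nonholonomic


end

theorem mainTheorem8
    -- the configuration manifold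
    {E : Type*} [NormedAddCommGroup E] [NormedSpace ℝ E] [FiniteDimensional ℝ E]
    {Q : Type*} [TopologicalSpace Q] [ChartedSpace E Q] [IsManifold 𝓘(ℝ, E) ∞ Q]
    [T2Space Q] [SecondCountableTopology Q]
    -- the symmetry Lie group, acting smoothly, freely and properly
    {F : Type*} [NormedAddCommGroup F] [NormedSpace ℝ F] [FiniteDimensional ℝ F]
    {G : Type*} [TopologicalSpace G] [ChartedSpace F G] [Group G] [LieGroup 𝓘(ℝ, F) ∞ G]
    [T2Space G] [SecondCountableTopology G]
    [MulAction G Q]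
    (hsmooth : ContMDiff (𝓘(ℝ, F).prod 𝓘(ℝ, E)) 𝓘(ℝ, E) ∞ (fun x : G × Q => x.1 • x.2))
    (hfree : ∀ (g : G) (q : Q), g • q = q → g = 1)
    (hproper : ProperSMul G Q)
    -- the nonholonomic system, with invariant constraints and Lagrangian
    (S : Nonholonomic.System E Q)
    (hconstraint : ∀ (g : G) (q : Q), ∀ v ∈ S.constraint q,
      Nonholonomic.tangentAct g q v ∈ S.constraint (g • q))
    (hlagrangian : ∀ (g : G) (q : Q) (v : TangentSpace 𝓘(ℝ, E) q),
      S.lagrangian (g • q) (Nonholonomic.tangentAct g q v) = S.lagrangian q v)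
    (ξ : GroupLieAlgebra 𝓘(ℝ, F) G) :
    -- `𝐉^ξ` is a constant of motion for every `G`-invariant Hamiltonian on `M`; as `M` is closed and
    -- embedded in `T*Q`, the smooth functions on `M` are the restrictions of those on `T*Q`
    (∀ h : Nonholonomic.Cot E Q → ℝ,
      ContMDiff (Nonholonomic.cotModel E) 𝓘(ℝ, ℝ) ∞ h →
      (∀ (g : G), ∀ p ∈ S.M, h (Nonholonomic.lift g p) = h p) →
      S.IsConstantOfMotion h (Nonholonomic.momentum ξ)) ↔
    -- `ξ_M ∈ Γ(𝒱 ∩ ℛ°)`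
    S.IsSectionOn Set.univ
      (fun p => (Nonholonomic.Ver F G p : Set (Nonholonomic.TCot p)) ∩
        S.smoothCoannihilator (S.reaction F G) p)
      (Nonholonomic.generator ξ) := by
  open Nonholonomic in
  have hgen := contMDiff_generator (E := E) (Q := Q) hsmooth ξ
  constructor
  · intro hJ
    refine ⟨isOpen_univ, hgen.contMDiffOn, fun p hp => ?_⟩
    have hTM : ∀ q ∈ S.M, ∀ η : GroupLieAlgebra 𝓘(ℝ, F) G, generatorMap q η ∈ S.TM q :=
      fun q hq η => S.generatorMap_mem_TM hsmooth hconstraint hlagrangian hq η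
    refine ⟨hTM p hp.2 ξ, ⟨ξ, rfl⟩, univ, generator ξ, mem_univ p,
      ⟨isOpen_univ, hgen.contMDiffOn, fun q hq => ⟨hTM q hq.2 ξ, hTM q hq.2 ξ⟩⟩, rfl, ?_⟩
    rintro O' β' - hβ' q ⟨⟨-, hqO'⟩, hqM⟩
    obtain ⟨O, β, X, hqO, hβ, hX, hβX, heq⟩ := hβ'.2.2 q ⟨hqO', hqM⟩
    have heq' : β' q (generator ξ q) = β q (generator ξ q) :=
      DFunLike.congr_fun heq ⟨generator ξ q, hTM q hqM ξ⟩
    -- an invariant Hamiltonian whose reaction force at `q` is `β q`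
    have hα : ∀ η : GroupLieAlgebra 𝓘(ℝ, F) G,
        (β q + omegaCan q (X q)) (generatorMap q η) = 0 := fun η =>
      hβX.2.2 q ⟨hqO, hqM⟩ ⟨generatorMap q η, hTM q hqM η⟩ ⟨η, rfl⟩
    obtain ⟨h, hh, hG, hdh⟩ : ∃ h : Cot E Q → ℝ, ContMDiff (cotModel E) 𝓘(ℝ, ℝ) ∞ h ∧
        (∀ (g : G) p, h (lift g p) = h p) ∧ diff h q = β q + omegaCan q (X q) := by
      let := liftAction hsmooth
      have := properSMul_lift hsmooth hproper
      exact exists_invariant_differential_eq (I := cotModel E) (P := Cot E Q)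
        (contMDiff_lift hsmooth) (lift_free hfree) q _ hα
    have hXH := (hX.2.2 q ⟨hqO, hqM⟩).2.1
    have hXh : X q = S.hamiltonianField h q := by
      refine S.eq_hamiltonianField hXH fun w hw => ?_
      have h1 : β q w = 0 := hβ.2.2 q ⟨hqO, hqM⟩ ⟨w, hw.1⟩ hw
      have h2 : diff h q w = β q w + omegaCan q (X q) w := DFunLike.congr_fun hdh w
      rw [h2, h1, zero_add]
    obtain ⟨ε, hε, c, hc0, hc⟩ := S.exists_isSolution hh hqM
    have h0 : (0 : ℝ) ∈ Ioo (-ε) ε := ⟨by linarith, hε⟩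
    -- `𝐉^ξ` is constant along the solution through `q`, whose velocity there is `X q`
    have hdJ : diff (momentum ξ) q (X q) = 0 := by
      have h1 := hasDerivAt_comp_curve
        ((contMDiff_momentum hsmooth ξ).mdifferentiable (by simp) (c 0)) (hc.hasMFDerivAt h0)
      have h2 : (momentum ξ ∘ c) =ᶠ[𝓝 0] fun _ => momentum ξ q := by
        filter_upwards [isOpen_Ioo.mem_nhds h0] with t ht
        rw [← hc0]
        exact hJ h hh (fun g p _ => hG g p) _ _ c hc t ht 0 h0
      have h3 := h1.unique ((hasDerivAt_const (0 : ℝ) (momentum ξ q)).congr_of_eventuallyEq h2)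
      rw [hc0] at h3
      rw [hXh]
      exact h3
    rw [diff_momentum hsmooth, omegaCan_antisymm, neg_eq_zero] at hdJ
    rw [heq']
    have h4 : β q (generator ξ q) + omegaCan q (X q) (generator ξ q) = 0 := hα ξ
    rwa [hdJ, add_zero] at h4
  · intro hsec h hh hG a b c hc s hs t ht
    -- the derivative of `𝐉^ξ` along `c` is the value of the reaction force on `ξ_M`
    have hd : ∀ t ∈ Ioo a b, HasDerivAt (momentum ξ ∘ c) 0 t := by
      intro t ht
      have hM := (hc.2 t ht).1
      obtain ⟨O, X, hO, -, hX, hann⟩ := (hsec.2.2 (c t) ⟨mem_univ _, hM⟩).2.2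
      have h1 := hann univ _ (mem_univ _) (S.isCosectionOn_reaction hsmooth hh hG) (c t)
        ⟨⟨hO, mem_univ _⟩, hM⟩
      have h2 : diff h (c t) (generator ξ (c t)) -
          omegaCan (c t) (S.hamiltonianField h (c t)) (generator ξ (c t)) = 0 := hX ▸ h1
      have h3 : diff h (c t) (generator ξ (c t)) = 0 :=
        diff_generatorMap_eq_zero hsmooth hh (fun g => hG g _ hM) ξ
      have h4 : diff (momentum ξ) (c t) (S.hamiltonianField h (c t)) = 0 := by
        rw [diff_momentum hsmooth, omegaCan_antisymm]
        linarith
      have h5 := hasDerivAt_comp_curve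
        ((contMDiff_momentum hsmooth ξ).mdifferentiable (by simp) (c t)) (hc.hasMFDerivAt ht)
      exact h4 ▸ h5
    exact isOpen_Ioo.is_const_of_deriv_eq_zero isPreconnected_Ioo
      (fun t ht => (hd t ht).differentiableAt.differentiableWithinAt)
      (fun t ht => (hd t ht).deriv) hs ht
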